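/- Single incoming call push-pull protocol. There are $n\ge 1$ nodes, and initially exactly one of them is informed. In each round every node calls, independently, a node chosen uniformly at random among all $n$ nodes (itself included). Every node that receives at least one call accepts exactly one of its incoming calls, chosen uniformly at random and independently of the other nodes; all other calls are dropped. If a call between two nodes is accepted and one of the two was informed at the beginning of the round, then both are informed at the end of the round. Informed nodes stay informed, and different rounds are independent. The rumor spreading time $T_n$ is the first $t$ such that all nodes are informed after $t$ rounds. **Theorem.** (i) $\mathbb{E}[T_n]$ is finite and $$\mathbb{E}[T_n]=\log_{3-2/e} n+\tfrac12\ln n+O(1),$$ that is, there is an absolute constant $C$ such that $\left|\mathbb{E}[T_n]-\log_{3-2/e}n-\tfrac12\ln n\right|\le C$ for all $n\ge1$. For a nonempty set $A$ of informed nodes at the beginning of a round, let $u=n-|A|$ be the number of uninformed nodes, let $X_x$ be the indicator of the event that the uninformed node $x\notin A$ becomes informed in this round, and let $p_A(x)=\Pr[X_x=1]$. (ii) The protocol satisfies the upper and the lower exponential shrinking conditions with $\rho_n=2$. Upper: there are constants $0<g<1$, $a,c\ge0$ with $e^{-2}+ag<1$ such that for all sufficiently large $n$ and all $A\neq\emptyset$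 with $u\le gn$ we have $1-p_A(x)\le e^{-2}+a\frac un$ for all $x\notin A$ and $\operatorname{Cov}[X_x,X_y]\le\frac cu$ for all distinct $x,y\notin A$. Lower: there are constants $0<g<1$, $a,c\ge0$ such that for all sufficiently large $n$ and all $A\ne\emptyset$ with $u\le gn$ we have $1-p_A(x)\ge e^{-2}-a\frac un$ for all $x\notin A$ and $\operatorname{Cov}[X_x,X_y]\le\frac cu$ for all distinct $x,y\notin A$. (iii) The double logarithmic end phase is lost: for no $\alpha\in(0,1]$ and $\ell>1$ does the protocol satisfy the upper double exponential shrinking conditions, i.e. there are no constants $0<g\le1$, $a,c\ge0$ with $ag^{\ell-1}<1$ such that for all sufficiently large $n$ and all $A\neq\emptyset$ with $n^{1-\alpha}\le u\le gn$ we have $1-p_A(x)\le a\left(\frac un\right)^{\ell-1}$ for all $x\notin A$ and $\operatorname{Cov}[X_x,X_y]\le c\frac n{u^2}$ for all distinct $x,y\notin A$. -/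

import Mathlib

open MeasureTheory ProbabilityTheory
open scoped ENNReal

noncomputable section

/-! ### One round of the push-pull protocol with a single answered incoming call

The nodes of the complete graph are the elements of `Fin n`. -/

/-- The outcome of one round. In the first component, `r.1 u` is the node that `u` calls. In the
second component, `r.2 v` is the caller whose call `v` accepts (`none` if nobody calls `v`). -/
def Round (n : ℕ) : Type :=
  (Fin n → Fin n) × (Fin n → Option (Fin n))

instance (n : ℕ) : MeasurableSpace (Round n) := ⊤

/-- The set of nodes that call `v`, when every node `u` calls `call u`. -/
def callers {n : ℕ} (call : Fin n → Fin n) (v : Fin n) : Finset (Fin n) :=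
  Finset.univ.filter fun u => call u = v

/-- The answers that are open to `v`: one of its incoming calls, or `none` if there is none. -/
def answers {n : ℕ} (call : Fin n → Fin n) (v : Fin n) : Finset (Option (Fin n)) :=
  if (callers call v).Nonempty then (callers call v).image some else {none}

theorem answers_nonempty {n : ℕ} (call : Fin n → Fin n) (v : Fin n) :
    (answers call v).Nonempty := by
  unfold answers
  split_ifs with h
  · exact h.image _
  · exact Finset.singleton_nonempty _

theorem piFinset_answers_nonempty {n : ℕ} (call : Fin n → Fin n) :
    (Fintype.piFinset (answers call)).Nonempty :=
  Fintype.piFinset_nonempty.2 (answers_nonempty call)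

/-- The law of one round. First each node calls, independently, a uniformly random node (possibly
itself): this is the uniform distribution on all functions `Fin n → Fin n`. Then each node that is
called accepts, independently of the other nodes, a uniformly random one of its incoming calls:
this is the uniform distribution on the product over `v` of the sets `answers call v`. -/
def roundLaw (n : ℕ) : PMF (Round n) :=
  haveI : Nonempty (Fin n → Fin n) := ⟨id⟩
  (PMF.uniformOfFintype (Fin n → Fin n)).bind fun call =>
    (PMF.uniformOfFinset (Fintype.piFinset (answers call)) (piFinset_answers_nonempty call)).map
      fun answer => (call, answer)

/-- The set of informed nodes after the round `r`, if `A` is the set of informed nodes at its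
start. An accepted call between two nodes, one of which is in `A`, informs the other one: node `v`
gets informed if it accepts the call of a node of `A` (push) or if its own call is accepted by a
node of `A` (pull). All other calls are dropped. -/
def nextInformed {n : ℕ} (r : Round n) (A : Finset (Fin n)) : Finset (Fin n) :=
  A ∪ Finset.univ.filter fun v => ∃ w ∈ A, r.2 v = some w ∨ r.2 w = some v

/-! ### The whole process and the rumor spreading time -/

/-- The law of an infinite sequence of independent rounds. -/
def processLaw (n : ℕ) : Measure (ℕ → Round n) :=
  Measure.infinitePi fun _ : ℕ => (roundLaw n).toMeasure

/-- The set of informed nodes at the end of the first `t` rounds, if only `s` is informed at the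
start. -/
def informed {n : ℕ} (s : Fin n) (ω : ℕ → Round n) : ℕ → Finset (Fin n)
  | 0 => {s}
  | t + 1 => nextInformed (ω t) (informed s ω t)

/-- The rumor spreading time: the first `t` such that all nodes are informed after `t` rounds
(`∞` if there is no such `t`). -/
def spreadingTime {n : ℕ} (s : Fin n) (ω : ℕ → Round n) : ℝ≥0∞ :=
  ⨅ (t : ℕ) (_ : informed s ω t = Finset.univ), (t : ℝ≥0∞)

/-- The expected rumor spreading time. -/
def expectedSpreadingTime {n : ℕ} (s : Fin n) : ℝ≥0∞ :=
  ∫⁻ ω, spreadingTime s ω ∂(processLaw n)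

/-! ### Success probabilities, covariances and shrinking conditions

The conditions are stated for any memoryless rumor spreading process, given by the laws `R n A` of
the set of informed nodes at the end of a round that starts with the set `A ⊆ Fin n` of informed
nodes. -/

/-- The indicator random variable of the event that `x` is informed. -/
def informedIndicator {n : ℕ} (x : Fin n) (B : Finset (Fin n)) : ℝ :=
  if x ∈ B then 1 else 0

/-- The probability that `x` is informed at the end of a round that starts with the set `A` of
informed nodes. -/
def successProb (R : (n : ℕ) → Finset (Fin n) → PMF (Finset (Fin n))) {n : ℕ}
    (A : Finset (Fin n)) (x : Fin n) : ℝ :=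
  (R n A).toMeasure.real {B | x ∈ B}

/-- The covariance of the indicator random variables of the events that `x` and `y` are informed at
the end of a round that starts with the set `A` of informed nodes. -/
def roundCov (R : (n : ℕ) → Finset (Fin n) → PMF (Finset (Fin n))) {n : ℕ}
    (A : Finset (Fin n)) (x y : Fin n) : ℝ :=
  covariance (informedIndicator x) (informedIndicator y) (R n A).toMeasure

/-- The number of uninformed nodes if `A` is the set of informed nodes, as a real number. -/
def numUninformed {n : ℕ} (A : Finset (Fin n)) : ℝ :=
  ((Aᶜ.card : ℕ) : ℝ)

/-- The upper exponential shrinking conditions with parameters `ρ n`. -/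
def UpperExponentialShrinking (R : (n : ℕ) → Finset (Fin n) → PMF (Finset (Fin n)))
    (ρ : ℕ → ℝ) : Prop :=
  (∃ ρ₀ ρ₁ : ℝ, 0 < ρ₀ ∧ ∀ n, ρ₀ ≤ ρ n ∧ ρ n ≤ ρ₁) ∧
  ∃ g a c : ℝ, 0 < g ∧ g < 1 ∧ 0 ≤ a ∧ 0 ≤ c ∧ (∀ n, Real.exp (-ρ n) + a * g < 1) ∧
    ∃ N : ℕ, ∀ n ≥ N, ∀ A : Finset (Fin n), A.Nonempty → numUninformed A ≤ g * n →
      (∀ x, x ∉ A → 1 - successProb R A x ≤ Real.exp (-ρ n) + a * (numUninformed A / n)) ∧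
      (∀ x y, x ∉ A → y ∉ A → x ≠ y → roundCov R A x y ≤ c / numUninformed A)

/-- The lower exponential shrinking conditions with parameters `ρ n`. -/
def LowerExponentialShrinking (R : (n : ℕ) → Finset (Fin n) → PMF (Finset (Fin n)))
    (ρ : ℕ → ℝ) : Prop :=
  (∃ ρ₀ ρ₁ : ℝ, 0 < ρ₀ ∧ ∀ n, ρ₀ ≤ ρ n ∧ ρ n ≤ ρ₁) ∧
  ∃ g a c : ℝ, 0 < g ∧ g < 1 ∧ 0 ≤ a ∧ 0 ≤ c ∧
    ∃ N : ℕ, ∀ n ≥ N, ∀ A : Finset (Fin n), A.Nonempty → numUninformed A ≤ g * n →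
      (∀ x, x ∉ A → Real.exp (-ρ n) - a * (numUninformed A / n) ≤ 1 - successProb R A x) ∧
      (∀ x y, x ∉ A → y ∉ A → x ≠ y → roundCov R A x y ≤ c / numUninformed A)

/-- The upper double exponential shrinking conditions with exponent `ℓ`, as long as the number of
uninformed nodes is at least `n ^ (1 - α)`. (The case `α = 1` covers all rounds, up to the end.) -/
def UpperDoubleExponentialShrinking (R : (n : ℕ) → Finset (Fin n) → PMF (Finset (Fin n)))
    (α ℓ : ℝ) : Prop :=
  ∃ g a c : ℝ, 0 < g ∧ g ≤ 1 ∧ 0 ≤ a ∧ 0 ≤ c ∧ a * g ^ (ℓ - 1) < 1 ∧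
    ∃ N : ℕ, ∀ n ≥ N, ∀ A : Finset (Fin n), A.Nonempty →
      (n : ℝ) ^ (1 - α) ≤ numUninformed A → numUninformed A ≤ g * n →
      (∀ x, x ∉ A → 1 - successProb R A x ≤ a * (numUninformed A / n) ^ (ℓ - 1)) ∧
      (∀ x y, x ∉ A → y ∉ A → x ≠ y → roundCov R A x y ≤ c * (n / numUninformed A ^ 2))

/-- The push-pull protocol with a single answered incoming call as a memoryless process. -/
def singleCallPushPull (n : ℕ) (A : Finset (Fin n)) : PMF (Finset (Fin n)) :=
  (roundLaw n).map fun r => nextInformed r A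

end

noncomputable section

/-! One round can be computed exactly. Permuting the callers preserves its law, so any j calls with
distinct callers and distinct callees are accepted with one common probability (`real_edges`), which
is asymptotically (q/n)^j with q = 1 - 1/e. An uninformed node learns the rumor by push or by pull.
With k = xn informed nodes, inclusion-exclusion therefore gives it the success probability 2qx -
q²x² + O(x/n) = 1 - (1 - qx)² + O(x/n). In the covariance of two such events the main terms cancel,
and at most O(x/n) remains (`covariance_nextInd_le`). As x → 1 the failure probability tends to (1 -
q)² = e⁻². This constant rate is exponential shrinking with ρ = 2, and its positivity rules out any
double exponential bound.

The expected time comes from one potential for the whole process, without a division into phases: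
`mainPotential` = -log_{1+2q} κ + ½ ln(n - κ + 1). For small x the informed set grows by the factor
1 + 2q = 3 - 2/e per round, and for x near 1 the uninformed set shrinks by e⁻². At either end the
potential thus drops by one per round. In between, its drift differs from -1 by at most a multiple
of `driftError`, which accounts for the intermediate regime and for the random fluctuations
(`abs_integral_mainPotential_le`).

These errors add up to O(1), because the bounded function `correction` has drift at most
-`driftError`/8 (`integral_correction_le`). Adding a large multiple of it to plus or minus the
potential gives functions with drift at most -1 and at most +1 while the process is unfinished.
Additive drift (`sub_le_mul_expectedSpreadingTime`) turns them into an upper and a lower bound on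
the expected time. The drop of the potential from one informed node to n is the main term. -/

/-! ### The law of one round and its symmetry in the callers -/

instance (n : ℕ) : Fintype (Round n) :=
  inferInstanceAs (Fintype ((Fin n → Fin n) × (Fin n → Option (Fin n))))

instance (n : ℕ) : DiscreteMeasurableSpace (Round n) := ⟨fun _ => trivial⟩

/-- The law of one round, as a measure. -/
abbrev roundMeasure (n : ℕ) : Measure (Round n) := (roundLaw n).toMeasure

/-- The round with the given calls and answers. -/
def mkRound {n : ℕ} (call : Fin n → Fin n) (answer : Fin n → Option (Fin n)) : Round n :=
  (call, answer)

instance (n : ℕ) : Nonempty (Fin n → Fin n) := ⟨id⟩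

theorem roundLaw_eq (n : ℕ) : roundLaw n =
    (PMF.uniformOfFintype (Fin n → Fin n)).bind fun call =>
      (PMF.uniformOfFinset (Fintype.piFinset (answers call))
        (piFinset_answers_nonempty call)).map (mkRound call) := rfl

theorem some_mem_answers {n : ℕ} {call : Fin n → Fin n} {v w : Fin n} :
    some w ∈ answers call v ↔ call w = v := by
  unfold answers
  split_ifs with h
  · simp [callers]
  · simp only [Finset.mem_singleton, reduceCtorEq, false_iff]
    intro hw
    exact h ⟨w, by simp [callers, hw]⟩

theorem none_mem_answers {n : ℕ} {call : Fin n → Fin n} {v : Fin n} :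
    none ∈ answers call v ↔ ∀ w, call w ≠ v := by
  unfold answers
  split_ifs with h
  · simp only [Finset.mem_image, reduceCtorEq, and_false, exists_false, false_iff]
    obtain ⟨w, hw⟩ := h
    intro h'
    exact h' w (by simpa [callers] using hw)
  · simp only [Finset.mem_singleton, true_iff]
    intro w hw
    exact h ⟨w, by simp [callers, hw]⟩

theorem ae_answer_mem (n : ℕ) : ∀ᵐ r ∂roundMeasure n, ∀ v, r.2 v ∈ answers r.1 v := by
  rw [ae_iff, PMF.toMeasure_apply_eq_zero_iff _ (MeasurableSet.of_discrete)]
  rw [Set.disjoint_left]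
  intro r hr
  simp only [roundLaw_eq, PMF.support_bind, PMF.support_map, PMF.support_uniformOfFinset,
    Set.mem_iUnion, Set.mem_image] at hr
  obtain ⟨call, -, a, ha, rfl⟩ := hr
  rintro h
  exact h fun v => Fintype.mem_piFinset.1 ha v

theorem roundLaw_map_fst (n : ℕ) :
    (roundLaw n).map (fun r => r.1) = PMF.uniformOfFintype (Fin n → Fin n) := by
  simp only [roundLaw_eq, PMF.map_bind, PMF.map_comp]
  conv_rhs => rw [← PMF.bind_pure (PMF.uniformOfFintype (Fin n → Fin n))]
  congr 1
  funext call
  exact PMF.map_const _ _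

/-- Relabelling of the callers. -/
def relabelCallers {n : ℕ} (σ : Equiv.Perm (Fin n)) (r : Round n) : Round n :=
  (fun u => r.1 (σ.symm u), fun v => (r.2 v).map σ)

theorem answers_relabel {n : ℕ} (σ : Equiv.Perm (Fin n)) (call : Fin n → Fin n) (v : Fin n) :
    answers (fun u => call (σ.symm u)) v = (answers call v).image (Option.map σ) := by
  ext o
  simp only [Finset.mem_image]
  constructor
  · intro h
    refine ⟨o.map σ.symm, ?_, by simp⟩
    cases o with
    | none =>
      rw [none_mem_answers] at h
      simp only [Option.map_none, none_mem_answers]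
      intro w hw
      exact h (σ w) (by simpa using hw)
    | some w =>
      rw [some_mem_answers] at h
      simpa [some_mem_answers] using h
  · rintro ⟨o, h, rfl⟩
    cases o with
    | none =>
      rw [none_mem_answers] at h
      simp only [Option.map_none, none_mem_answers]
      intro w hw
      exact h _ hw
    | some w =>
      rw [some_mem_answers] at h
      simpa [some_mem_answers] using h

theorem PMF.map_uniformOfFinset {α β : Type*} [DecidableEq β] (s : Finset α) (hs : s.Nonempty)
    (f : α → β) (hf : Function.Injective f) :
    (PMF.uniformOfFinset s hs).map f = PMF.uniformOfFinset (s.image f) (hs.image f) := by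
  classical
  ext b
  rw [PMF.map_apply, PMF.uniformOfFinset_apply, Finset.card_image_of_injective s hf]
  by_cases hb : b ∈ s.image f
  · obtain ⟨a, ha, rfl⟩ := Finset.mem_image.1 hb
    rw [tsum_eq_single a]
    · simp [ha, hf.eq_iff]
    · intro a' ha'
      simp [hf.eq_iff, ha'.symm]
  · rw [if_neg hb, ENNReal.tsum_eq_zero]
    intro a
    split_ifs with h
    · subst h
      rw [PMF.uniformOfFinset_apply_of_notMem]
      intro ha
      exact hb (Finset.mem_image_of_mem f ha)
    · rfl

theorem PMF.bind_uniformOfFintype_equiv {α β : Type*} [Fintype α] [Nonempty α] (e : α ≃ α)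
    (f : α → PMF β) :
    ((PMF.uniformOfFintype α).bind fun a => f (e a)) = (PMF.uniformOfFintype α).bind f := by
  ext b
  simp only [PMF.bind_apply, PMF.uniformOfFintype_apply]
  exact e.tsum_eq (fun a => (Fintype.card α : ℝ≥0∞)⁻¹ * f a b)

/-- Precomposition with a permutation preserves the uniform law of the calls. For fixed calls,
relabelling maps the admissible answers bijectively onto those of the relabelled calls, so the
uniform law of the answers is carried along. -/
theorem roundLaw_map_relabel {n : ℕ} (σ : Equiv.Perm (Fin n)) :
    (roundLaw n).map (relabelCallers σ) = roundLaw n := by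
  have hinj : Function.Injective
      (fun (a : Fin n → Option (Fin n)) v => (a v).map σ) := by
    intro a b hab
    funext v
    exact Option.map_injective σ.injective (congrFun hab v)
  have key : ∀ call : Fin n → Fin n,
      (Fintype.piFinset (answers call)).image (fun a v => (a v).map σ) =
        Fintype.piFinset (answers fun u => call (σ.symm u)) := by
    intro call
    ext a
    simp only [Finset.mem_image, Fintype.mem_piFinset, answers_relabel]
    constructor
    · rintro ⟨b, hb, rfl⟩ v
      exact ⟨b v, hb v, rfl⟩
    · intro h
      choose b hb hb' using h
      exact ⟨b, hb, funext hb'⟩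
  have step : ∀ call : Fin n → Fin n,
      ((PMF.uniformOfFinset (Fintype.piFinset (answers call))
        (piFinset_answers_nonempty call)).map (mkRound call)).map (relabelCallers σ) =
      (PMF.uniformOfFinset (Fintype.piFinset (answers fun u => call (σ.symm u)))
        (piFinset_answers_nonempty _)).map (mkRound fun u => call (σ.symm u)) := by
    intro call
    have h := PMF.map_uniformOfFinset (Fintype.piFinset (answers call))
      (piFinset_answers_nonempty call) _ hinj
    simp only [key] at h
    rw [← h, PMF.map_comp, PMF.map_comp]
    rfl
  have h := PMF.bind_uniformOfFintype_equiv (Equiv.arrowCongr σ (Equiv.refl (Fin n)))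
    (fun call => (PMF.uniformOfFinset (Fintype.piFinset (answers call))
        (piFinset_answers_nonempty call)).map (mkRound call))
  rw [roundLaw_eq, PMF.map_bind, ← h]
  congr 1
  funext call
  exact step call

/-! ### Exact probabilities of called nodes and accepted calls -/

/-- The probability that each of `j` given nodes is called. -/
def hitProb (n j : ℕ) : ℝ :=
  ∑ i ∈ Finset.range (j + 1), (-1) ^ i * (j.choose i : ℝ) * (((n : ℝ) - i) / n) ^ n

/-- The probability that `j` given calls with distinct callers and distinct callees are accepted. -/
def edgeProb (n j : ℕ) : ℝ := hitProb n j / (n.descFactorial j : ℝ)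

theorem real_not_called {n : ℕ} (I : Finset (Fin n)) :
    (roundMeasure n).real {r | ∀ w, r.1 w ∉ I} = (((n : ℝ) - I.card) / n) ^ n := by
  have h : (roundMeasure n) {r | ∀ w, r.1 w ∉ I} =
      ((PMF.uniformOfFintype (Fin n → Fin n)).toMeasure {c | ∀ w, c w ∉ I}) := by
    have hm := PMF.toMeasure_map (fun r : Round n => r.1) (roundLaw n) Measurable.of_discrete
    have hf : PMF.map (fun r : Round n => r.1) (roundLaw n) = _ := roundLaw_map_fst n
    rw [hf] at hm
    rw [← hm, Measure.map_apply Measurable.of_discrete MeasurableSet.of_discrete]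
    rfl
  rw [measureReal_def, h, PMF.toMeasure_uniformOfFintype_apply _ MeasurableSet.of_discrete]
  have hc : Fintype.card {c : Fin n → Fin n | ∀ w, c w ∉ I} = (n - I.card) ^ n := by
    rw [← Set.toFinset_card]
    have : {c : Fin n → Fin n | ∀ w, c w ∉ I}.toFinset = Fintype.piFinset fun _ => Iᶜ := by
      ext c
      simp
    rw [this, Fintype.card_piFinset]
    simp [Finset.card_compl]
  rw [hc]
  have hI : I.card ≤ n := by simpa using I.card_le_univ
  have hcast : ((n : ℝ≥0∞) - I.card).toReal = (n : ℝ) - I.card := by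
    rw [← Nat.cast_sub hI, ← ENNReal.natCast_sub, ENNReal.toReal_natCast]
  simp [div_pow, hcast]

theorem real_all_called {n : ℕ} (J : Finset (Fin n)) :
    (roundMeasure n).real {r | ∀ v ∈ J, ∃ w, r.1 w = v} = hitProb n J.card := by
  classical
  have h1 : ∀ r : Round n, ({r : Round n | ∀ v ∈ J, ∃ w, r.1 w = v}.indicator 1 r : ℝ) =
      ∑ I ∈ J.powerset, (-1) ^ I.card * ({r : Round n | ∀ w, r.1 w ∉ I}.indicator 1 r : ℝ) := by
    intro r
    -- Inclusion-exclusion: the indicator is the product over v of 1 - [nobody calls v], to be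
    -- expanded over the sets I of uncalled nodes.
    have e1 : ({r : Round n | ∀ v ∈ J, ∃ w, r.1 w = v}.indicator 1 r : ℝ) =
        ∏ v ∈ J, (1 + (-(if ∀ w, r.1 w ≠ v then 1 else 0))) := by
      by_cases hr : ∀ v ∈ J, ∃ w, r.1 w = v
      · rw [Set.indicator_of_mem (by exact hr), Finset.prod_eq_one]
        · rfl
        · intro v hv
          obtain ⟨w, hw⟩ := hr v hv
          rw [if_neg (fun h => h w hw)]
          simp
      · rw [Set.indicator_of_notMem (by exact hr)]
        push Not at hr
        obtain ⟨v, hv, hw⟩ := hr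
        rw [Finset.prod_eq_zero hv]
        simp [hw]
    rw [e1, Finset.prod_one_add]
    refine Finset.sum_congr rfl fun I _ => ?_
    rw [Finset.prod_neg]
    congr 1
    by_cases hr : ∀ w, r.1 w ∉ I
    · rw [Set.indicator_of_mem (by exact hr), Finset.prod_eq_one]
      · rfl
      · intro v hv
        rw [if_pos]
        intro w hw
        exact hr w (hw ▸ hv)
    · rw [Set.indicator_of_notMem (by exact hr)]
      push Not at hr
      obtain ⟨w, hw⟩ := hr
      rw [Finset.prod_eq_zero hw]
      simp only [ite_eq_right_iff, one_ne_zero, imp_false]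
      intro h
      exact h w rfl
  rw [← integral_indicator_one MeasurableSet.of_discrete, integral_congr_ae (ae_of_all _ h1),
    integral_finsetSum _ fun _ _ => Integrable.of_finite]
  simp only [integral_const_mul, integral_indicator_one MeasurableSet.of_discrete,
    real_not_called]
  rw [Finset.sum_powerset_apply_card
    (fun i => (-1 : ℝ) ^ i * (((n : ℝ) - i) / n) ^ n), hitProb]
  refine Finset.sum_congr rfl fun i _ => ?_
  rw [nsmul_eq_mul]
  ring

theorem exists_perm_of_injective {n j : ℕ} {w w' : Fin j → Fin n} (hw : Function.Injective w)
    (hw' : Function.Injective w') : ∃ σ : Equiv.Perm (Fin n), ∀ i, σ (w i) = w' i := by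
  have := Equiv.Perm.isMultiplyPretransitive (Fin n) j
  obtain ⟨σ, hσ⟩ := MulAction.exists_smul_eq (Equiv.Perm (Fin n)) (⟨w, hw⟩ : Fin j ↪ Fin n)
    ⟨w', hw'⟩
  exact ⟨σ, fun i => DFunLike.congr_fun hσ i⟩

theorem real_edges_perm {n j : ℕ} (v w : Fin j → Fin n) (σ : Equiv.Perm (Fin n)) :
    (roundMeasure n).real {r | ∀ i, r.2 (v i) = some (σ (w i))} =
      (roundMeasure n).real {r | ∀ i, r.2 (v i) = some (w i)} := by
  rw [measureReal_def, measureReal_def]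
  congr 1
  conv_lhs => rw [roundMeasure, ← roundLaw_map_relabel σ,
    ← PMF.toMeasure_map _ _ Measurable.of_discrete,
    Measure.map_apply Measurable.of_discrete MeasurableSet.of_discrete]
  congr 1
  ext r
  change (∀ i, (r.2 (v i)).map σ = some (σ (w i))) ↔ ∀ i, r.2 (v i) = some (w i)
  simp

/-- The law of the accepted calls: any `j` calls with distinct callers and distinct callees are
accepted with the same probability. -/
theorem real_edges {n j : ℕ} (hj : j ≤ n) {v w : Fin j → Fin n}
    (hv : Function.Injective v) (hw : Function.Injective w) :
    (roundMeasure n).real {r | ∀ i, r.2 (v i) = some (w i)} = edgeProb n j := by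
  classical
  -- Almost surely, if all v i are called then exactly one injection f records the accepted callers:
  -- every called node accepts a call, and a node calls only once, so distinct callees have distinct
  -- callers.
  have hsum : ∑ f : Fin j ↪ Fin n, (roundMeasure n).real {r | ∀ i, r.2 (v i) = some (f i)} =
      hitProb n j := by
    have hJ := real_all_called (Finset.univ.map ⟨v, hv⟩)
    simp only [Finset.card_map, Finset.card_univ, Fintype.card_fin, Finset.mem_map,
      Finset.mem_univ, true_and, Function.Embedding.coeFn_mk, forall_exists_index,
      forall_apply_eq_imp_iff] at hJ
    rw [← hJ]
    simp only [← integral_indicator_one (μ := roundMeasure n) (MeasurableSet.of_discrete)]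
    rw [← integral_finsetSum _ fun _ _ => Integrable.of_finite]
    refine integral_congr_ae ?_
    filter_upwards [ae_answer_mem n] with r hr
    by_cases h : ∀ i, ∃ w, r.1 w = v i
    · rw [Set.indicator_of_mem (by exact h)]
      have h' : ∀ i, ∃ w, r.2 (v i) = some w := by
        intro i
        have h1 := hr (v i)
        cases h2 : r.2 (v i) with
        | some w => exact ⟨w, rfl⟩
        | none =>
          rw [h2, none_mem_answers] at h1
          obtain ⟨w, hw⟩ := h i
          exact absurd hw (h1 w)
      choose g hg using h'
      have hginj : Function.Injective g := by
        intro a b hab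
        have ha := hr (v a)
        have hb := hr (v b)
        rw [hg, some_mem_answers] at ha hb
        exact hv (by rw [← ha, ← hb, hab])
      rw [Finset.sum_eq_single (⟨g, hginj⟩ : Fin j ↪ Fin n)]
      · rw [Set.indicator_of_mem (by exact hg)]
      · intro f _ hf
        rw [Set.indicator_of_notMem]
        intro hf'
        apply hf
        ext i
        have := (hf' i).symm.trans (hg i)
        simpa using congrArg Fin.val (Option.some.inj this)
      · simp
    · rw [Set.indicator_of_notMem (by exact h)]
      refine Finset.sum_eq_zero fun f _ => ?_
      rw [Set.indicator_of_notMem]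
      intro hf
      apply h
      intro i
      have h1 := hr (v i)
      rw [hf i, some_mem_answers] at h1
      exact ⟨_, h1⟩
  -- By the symmetry in the callers all terms of the sum agree, so each is the total divided by the
  -- number of injections.
  have hconst : ∀ f : Fin j ↪ Fin n, (roundMeasure n).real {r | ∀ i, r.2 (v i) = some (f i)} =
      (roundMeasure n).real {r | ∀ i, r.2 (v i) = some (w i)} := by
    intro f
    obtain ⟨σ, hσ⟩ := exists_perm_of_injective hw f.injective
    simp only [← hσ]
    exact real_edges_perm v w σ
  simp only [hconst] at hsum
  rw [Finset.sum_const, Finset.card_univ, Fintype.card_embedding_eq, nsmul_eq_mul] at hsum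
  simp only [Fintype.card_fin] at hsum
  have hpos : (0 : ℝ) < n.descFactorial j := by
    exact_mod_cast Nat.descFactorial_pos.2 hj
  rw [edgeProb, eq_div_iff hpos.ne', ← hsum]
  ring

/-! ### Asymptotics of the acceptance probabilities -/

/-- With t = i/n, the bases 1 - t and e^(-t) lie in [0,1] and differ by at most t². Passing to n-th
powers costs a factor of at most n. -/
theorem abs_one_sub_div_pow_sub_exp_le {n i : ℕ} (hn : 0 < n) (hi : i ≤ n) :
    |(((n : ℝ) - i) / n) ^ n - Real.exp (-i)| ≤ (i : ℝ) ^ 2 / n := by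
  have hn' : (0 : ℝ) < n := by exact_mod_cast hn
  have hi' : (i : ℝ) ≤ n := by exact_mod_cast hi
  set t : ℝ := i / n with ht
  have ht0 : 0 ≤ t := by positivity
  have ht1 : t ≤ 1 := by rw [ht, div_le_one hn']; exact hi'
  have e1 : ((n : ℝ) - i) / n = 1 - t := by rw [ht]; field_simp
  have e2 : Real.exp (-i) = Real.exp (-t) ^ n := by
    rw [← Real.exp_nat_mul, ht]
    congr 1
    field_simp
  have h1 : |Real.exp (-t) - 1 - -t| ≤ (-t) ^ 2 :=
    Real.abs_exp_sub_one_sub_id_le (by rwa [abs_neg, abs_of_nonneg ht0])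
  have h2 := abs_pow_sub_pow_le (1 - t) (Real.exp (-t)) n
  have h3 : max |1 - t| |Real.exp (-t)| ^ (n - 1) ≤ 1 := by
    apply pow_le_one₀ (by positivity)
    refine max_le ?_ ?_
    · rw [abs_le]; constructor <;> linarith
    · rw [Real.abs_exp, Real.exp_le_one_iff]; linarith
  rw [e1, e2]
  have h4 : |1 - t - Real.exp (-t)| ≤ t ^ 2 := by
    rw [abs_sub_comm]
    calc |Real.exp (-t) - (1 - t)| = |Real.exp (-t) - 1 - -t| := by congr 1; ring
      _ ≤ (-t) ^ 2 := h1
      _ = t ^ 2 := by ring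
  calc |(1 - t) ^ n - Real.exp (-t) ^ n|
      ≤ |1 - t - Real.exp (-t)| * n * max |1 - t| |Real.exp (-t)| ^ (n - 1) := h2
    _ ≤ |1 - t - Real.exp (-t)| * n * 1 := by gcongr
    _ ≤ t ^ 2 * n * 1 := by gcongr
    _ = (i : ℝ) ^ 2 / n := by rw [ht]; field_simp

/-- The limit, as `n → ∞`, of the probability that a node is called. -/
def limitHit : ℝ := 1 - Real.exp (-1)

theorem exp_neg_one_lt_half : Real.exp (-1) < 1 / 2 := by
  rw [Real.exp_neg, inv_lt_comm₀ (Real.exp_pos _) (by norm_num)]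
  have := Real.exp_one_gt_d9
  norm_num
  linarith

theorem half_lt_limitHit : 1 / 2 < limitHit := by
  have := exp_neg_one_lt_half
  unfold limitHit
  linarith

theorem limitHit_lt_one : limitHit < 1 := by
  have := Real.exp_pos (-1)
  unfold limitHit
  linarith

theorem abs_hitProb_sub_le {n j : ℕ} (hn : 0 < n) (hj : j ≤ n) :
    |hitProb n j - limitHit ^ j| ≤ 2 ^ j * (j : ℝ) ^ 2 / n := by
  have h : limitHit ^ j =
      ∑ i ∈ Finset.range (j + 1), (-1) ^ i * (j.choose i : ℝ) * Real.exp (-i) := by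
    rw [limitHit, sub_eq_neg_add, add_pow]
    refine Finset.sum_congr rfl fun i _ => ?_
    have : Real.exp (-i) = Real.exp (-1) ^ i := by
      rw [← Real.exp_nat_mul]; congr 1; ring
    rw [this, neg_pow]
    ring
  rw [h, hitProb, ← Finset.sum_sub_distrib]
  calc _ ≤ ∑ i ∈ Finset.range (j + 1), |(-1) ^ i * (j.choose i : ℝ) * (((n : ℝ) - i) / n) ^ n -
        (-1) ^ i * (j.choose i : ℝ) * Real.exp (-i)| := Finset.abs_sum_le_sum_abs _ _
    _ ≤ ∑ i ∈ Finset.range (j + 1), (j.choose i : ℝ) * ((j : ℝ) ^ 2 / n) := by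
        refine Finset.sum_le_sum fun i hi => ?_
        have hij : i ≤ j := Nat.lt_succ_iff.1 (Finset.mem_range.1 hi)
        rw [← mul_sub, abs_mul, abs_mul, abs_pow, abs_neg, abs_one, one_pow, one_mul, Nat.abs_cast]
        gcongr
        refine (abs_one_sub_div_pow_sub_exp_le hn (hij.trans hj)).trans ?_
        gcongr
    _ = 2 ^ j * (j : ℝ) ^ 2 / n := by
        rw [← Finset.sum_mul, ← Nat.cast_sum, Nat.sum_range_choose]
        push_cast
        ring

theorem one_sub_sq_div_le_descFactorial_div_pow {n j : ℕ} (hn : 0 < n) (hj : j ≤ n) :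
    1 - (j : ℝ) ^ 2 / n ≤ (n.descFactorial j : ℝ) / (n : ℝ) ^ j := by
  have hn' : (0 : ℝ) < n := by exact_mod_cast hn
  have hj' : (j : ℝ) ≤ n := by exact_mod_cast hj
  have h1 : ((n : ℝ) - j) ^ j ≤ n.descFactorial j := by
    have h := Nat.pow_sub_le_descFactorial n j
    have h2 : (n - j) ^ j ≤ n.descFactorial j :=
      le_trans (Nat.pow_le_pow_left (by omega) j) h
    rw [← Nat.cast_sub hj]
    exact_mod_cast h2
  have h2 : 1 + (j : ℝ) * (-(j / n)) ≤ (1 + -((j : ℝ) / n)) ^ j := by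
    apply one_add_mul_le_pow
    have : (j : ℝ) / n ≤ 1 := by rw [div_le_one hn']; exact hj'
    linarith
  calc 1 - (j : ℝ) ^ 2 / n = 1 + (j : ℝ) * (-(j / n)) := by ring
    _ ≤ (1 + -((j : ℝ) / n)) ^ j := h2
    _ = ((n : ℝ) - j) ^ j / (n : ℝ) ^ j := by
        rw [← div_pow]; congr 1; field_simp; ring
    _ ≤ _ := by gcongr

theorem hitProb_nonneg {n : ℕ} {j : ℕ} (hj : j ≤ n) : 0 ≤ hitProb n j := by
  obtain ⟨J, -, hJ⟩ := Finset.exists_subset_card_eq (s := (Finset.univ : Finset (Fin n)))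
    (n := j) (by simpa using hj)
  rw [← hJ, ← real_all_called]
  exact measureReal_nonneg

/-- The probability of `j` given accepted calls, scaled by its order of magnitude. -/
def scaledEdgeProb (n j : ℕ) : ℝ := (n : ℝ) ^ j * edgeProb n j

theorem edgeProb_eq {n : ℕ} (hn : 0 < n) (j : ℕ) :
    edgeProb n j = scaledEdgeProb n j / (n : ℝ) ^ j := by
  have hn' : (0 : ℝ) < n := by exact_mod_cast hn
  rw [scaledEdgeProb]
  field_simp

/-- The numerator contributes an error 2⁴·4²/n = 256/n and the falling factorial 16/n. Since n ≥ 32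
keeps the normalised falling factorial d above 1/2, the division at most doubles the sum 272/n. -/
theorem abs_scaledEdgeProb_sub_le {n j : ℕ} (hn : 32 ≤ n) (hj : j ≤ 4) :
    |scaledEdgeProb n j - limitHit ^ j| ≤ 1000 / n := by
  have hn0 : 0 < n := by omega
  have hjn : j ≤ n := by omega
  have hn' : (32 : ℝ) ≤ n := by exact_mod_cast hn
  have hj' : (j : ℝ) ≤ 4 := by exact_mod_cast hj
  have hnpos : (0 : ℝ) < n := by linarith
  set d : ℝ := (n.descFactorial j : ℝ) / (n : ℝ) ^ j with hd
  have hj2 : (j : ℝ) ^ 2 ≤ 16 := by nlinarith [(Nat.cast_nonneg j : (0 : ℝ) ≤ j)]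
  have hd1 : 1 - 16 / n ≤ d :=
    le_trans (by gcongr) (one_sub_sq_div_le_descFactorial_div_pow hn0 hjn)
  have hd2 : d ≤ 1 := by
    rw [hd, div_le_one (by positivity)]
    exact_mod_cast Nat.descFactorial_le_pow n j
  have h16 : (16 : ℝ) / n ≤ 1 / 2 := by
    rw [div_le_iff₀ hnpos]; linarith
  have hdpos : 1 / 2 ≤ d := by linarith
  have hs : scaledEdgeProb n j = hitProb n j / d := by
    rw [scaledEdgeProb, edgeProb, hd]
    field_simp
  have hq : 0 ≤ limitHit ^ j ∧ limitHit ^ j ≤ 1 := by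
    have h1 := half_lt_limitHit
    exact ⟨by positivity, pow_le_one₀ (by linarith) limitHit_lt_one.le⟩
  have hh := abs_hitProb_sub_le hn0 hjn
  have h2j : (2 : ℝ) ^ j * (j : ℝ) ^ 2 / n ≤ 256 / n := by
    have : (2 : ℝ) ^ j ≤ 2 ^ 4 := pow_le_pow_right₀ (by norm_num) hj
    have h3 : (2 : ℝ) ^ j * (j : ℝ) ^ 2 ≤ 2 ^ 4 * 16 := by gcongr
    gcongr
    linarith
  have key : |hitProb n j - limitHit ^ j * d| ≤ 272 / n := by
    calc |hitProb n j - limitHit ^ j * d|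
        = |(hitProb n j - limitHit ^ j) + limitHit ^ j * (1 - d)| := by congr 1; ring
      _ ≤ |hitProb n j - limitHit ^ j| + |limitHit ^ j * (1 - d)| := abs_add_le _ _
      _ ≤ 256 / n + 16 / n := by
          refine add_le_add (hh.trans h2j) ?_
          rw [abs_of_nonneg (mul_nonneg hq.1 (by linarith))]
          calc limitHit ^ j * (1 - d) ≤ 1 * (1 - d) := mul_le_mul_of_nonneg_right hq.2 (by linarith)
            _ ≤ 16 / n := by linarith
      _ = 272 / n := by ring
  have e : scaledEdgeProb n j - limitHit ^ j = (hitProb n j - limitHit ^ j * d) / d := by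
    rw [hs]
    field_simp
  rw [e, abs_div, abs_of_pos (by linarith : 0 < d), div_le_iff₀ (by linarith)]
  refine key.trans ?_
  have : (0 : ℝ) < 1 / n := by positivity
  have h1 : 1000 / (n : ℝ) * d = 1000 * (1 / n) * d := by ring
  have h2 : 272 / (n : ℝ) = 272 * (1 / n) := by ring
  rw [h1, h2]
  nlinarith

/-- Here the scaled probability is exactly 1 - (1 - 1/n)^n ≥ 1 - 1/e. Validity for every n ≥ 1 is
what later yields finiteness of the expectation for every n. -/
theorem half_le_scaledEdgeProb_one {n : ℕ} (hn : 0 < n) : 1 / 2 ≤ scaledEdgeProb n 1 := by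
  have hn' : (1 : ℝ) ≤ n := by exact_mod_cast hn
  have h : scaledEdgeProb n 1 = 1 - (1 - 1 / (n : ℝ)) ^ n := by
    simp only [scaledEdgeProb, edgeProb, hitProb, Finset.sum_range_succ, Finset.range_one,
      Finset.sum_singleton, Nat.descFactorial_one]
    have : ((n : ℝ) - 1) / n = 1 - 1 / n := by field_simp
    simp only [Nat.cast_one, Nat.cast_zero, this]
    simp
    field_simp
    ring
  have h2 : (1 - 1 / (n : ℝ)) ^ n ≤ Real.exp (-1) := by
    have : (1 - 1 / (n : ℝ)) ≤ Real.exp (-(1 / n)) := by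
      have := Real.add_one_le_exp (-(1 / (n : ℝ)))
      linarith
    calc (1 - 1 / (n : ℝ)) ^ n ≤ Real.exp (-(1 / n)) ^ n := by
          gcongr
          rw [sub_nonneg, div_le_one (by linarith)]
          exact hn'
      _ = Real.exp (-1) := by
          rw [← Real.exp_nat_mul]; congr 1; field_simp
  have := exp_neg_one_lt_half
  rw [h]
  linarith

/-! ### Mixed moments of the push and pull indicators -/

/-- The indicator of the event that `v` accepts the call of `w`. -/
def edge {n : ℕ} (v w : Fin n) (r : Round n) : ℝ := if r.2 v = some w then 1 else 0

/-- The indicator of the event that `x` accepts the call of a node of `A`. -/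
def pushInd {n : ℕ} (A : Finset (Fin n)) (x : Fin n) (r : Round n) : ℝ := ∑ w ∈ A, edge x w r

/-- The indicator of the event that a node of `A` accepts the call of `x`. -/
def pullInd {n : ℕ} (A : Finset (Fin n)) (x : Fin n) (r : Round n) : ℝ := ∑ w ∈ A, edge w x r

theorem integral_prod_edge {n j : ℕ} (hj : j ≤ n) {v w : Fin j → Fin n}
    (hv : Function.Injective v) (hw : Function.Injective w) :
    ∫ r, ∏ i, edge (v i) (w i) r ∂roundMeasure n = edgeProb n j := by
  rw [← real_edges hj hv hw, ← integral_indicator_one MeasurableSet.of_discrete]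
  refine integral_congr_ae (ae_of_all _ fun r => ?_)
  by_cases h : ∀ i, r.2 (v i) = some (w i)
  · rw [Set.indicator_of_mem (by exact h)]
    exact Finset.prod_eq_one fun i _ => if_pos (h i)
  · rw [Set.indicator_of_notMem (by exact h)]
    push Not at h
    obtain ⟨i, hi⟩ := h
    exact Finset.prod_eq_zero (Finset.mem_univ i) (if_neg hi)

theorem integral_edge {n : ℕ} (hn : 1 ≤ n) (v w : Fin n) :
    ∫ r, edge v w r ∂roundMeasure n = edgeProb n 1 := by
  have h := integral_prod_edge hn (v := ![v]) (w := ![w])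
    (Function.injective_of_subsingleton _) (Function.injective_of_subsingleton _)
  simpa using h

theorem integral_edge_two {n : ℕ} (hn : 2 ≤ n) {v v' w w' : Fin n} (hv : v ≠ v') (hw : w ≠ w') :
    ∫ r, edge v w r * edge v' w' r ∂roundMeasure n = edgeProb n 2 := by
  have h := integral_prod_edge hn (v := ![v, v']) (w := ![w, w'])
    (by simp [Function.Injective, Fin.forall_fin_succ, hv, hv.symm])
    (by simp [Function.Injective, Fin.forall_fin_succ, hw, hw.symm])
  simpa [Fin.prod_univ_succ] using h

theorem integral_edge_three {n : ℕ} (hn : 3 ≤ n) {v v' v'' w w' w'' : Fin n}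
    (hv : v ≠ v') (hv' : v ≠ v'') (hv'' : v' ≠ v'')
    (hw : w ≠ w') (hw' : w ≠ w'') (hw'' : w' ≠ w'') :
    ∫ r, edge v w r * edge v' w' r * edge v'' w'' r ∂roundMeasure n = edgeProb n 3 := by
  have h := integral_prod_edge hn (v := ![v, v', v'']) (w := ![w, w', w''])
    (by simp [Function.Injective, Fin.forall_fin_succ, hv, hv.symm, hv', hv'.symm, hv'',
      hv''.symm])
    (by simp [Function.Injective, Fin.forall_fin_succ, hw, hw.symm, hw', hw'.symm, hw'',
      hw''.symm])
  simpa [Fin.prod_univ_succ, mul_assoc] using h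

theorem integral_edge_four {n : ℕ} (hn : 4 ≤ n) {v₁ v₂ v₃ v₄ w₁ w₂ w₃ w₄ : Fin n}
    (hv : [v₁, v₂, v₃, v₄].Nodup) (hw : [w₁, w₂, w₃, w₄].Nodup) :
    ∫ r, edge v₁ w₁ r * edge v₂ w₂ r * edge v₃ w₃ r * edge v₄ w₄ r ∂roundMeasure n =
      edgeProb n 4 := by
  have h := integral_prod_edge hn (v := ![v₁, v₂, v₃, v₄]) (w := ![w₁, w₂, w₃, w₄])
    (by simpa using List.nodup_ofFn.1 (by simpa [List.ofFn_succ] using hv))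
    (by simpa using List.nodup_ofFn.1 (by simpa [List.ofFn_succ] using hw))
  simpa [Fin.prod_univ_succ, mul_assoc] using h

theorem edge_mul_edge_of_ne {n : ℕ} (v : Fin n) {w w' : Fin n} (hw : w ≠ w') (r : Round n) :
    edge v w r * edge v w' r = 0 := by
  unfold edge
  split_ifs with h h' <;> simp
  rw [h] at h'
  exact hw (Option.some.inj h')

theorem ae_edge_mul_edge_of_ne (n : ℕ) : ∀ᵐ r ∂roundMeasure n, ∀ v v' w : Fin n, v ≠ v' →
    edge v w r * edge v' w r = 0 := by
  filter_upwards [ae_answer_mem n] with r hr v v' w hv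
  unfold edge
  split_ifs with h h' <;> simp
  have h1 := hr v
  have h2 := hr v'
  rw [h, some_mem_answers] at h1
  rw [h', some_mem_answers] at h2
  exact hv (h1.symm.trans h2)

theorem sum_sum_ite_eq {α : Type*} [DecidableEq α] (A : Finset α) (m : ℝ) :
    ∑ w ∈ A, ∑ w' ∈ A, (if w = w' then 0 else m) = ((A.card : ℝ) ^ 2 - A.card) * m := by
  have h : ∀ w ∈ A, ∑ w' ∈ A, (if w = w' then 0 else m) = A.card * m - m := by
    intro w hw
    have : ∀ w', (if w = w' then 0 else m) = m - if w = w' then m else 0 := by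
      intro w'; split_ifs <;> simp
    simp [this, Finset.sum_sub_distrib, hw]
  rw [Finset.sum_congr rfl h, Finset.sum_const, nsmul_eq_mul]
  ring

section Moments

variable {n : ℕ} {A : Finset (Fin n)} {x y : Fin n}

theorem integral_pushInd (hn : 1 ≤ n) :
    ∫ r, pushInd A x r ∂roundMeasure n = A.card * edgeProb n 1 := by
  simp only [pushInd]
  rw [integral_finsetSum _ fun _ _ => Integrable.of_finite]
  simp [integral_edge hn]

theorem integral_pullInd (hn : 1 ≤ n) :
    ∫ r, pullInd A x r ∂roundMeasure n = A.card * edgeProb n 1 := by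
  simp only [pullInd]
  rw [integral_finsetSum _ fun _ _ => Integrable.of_finite]
  simp [integral_edge hn]

/-- Push and pull edges never clash: the callees are x and a node of A, the callers a node of A and
y. Hence all k² pairs contribute, also when x = y. -/
theorem integral_pushInd_mul_pullInd (hn : 2 ≤ n) (hx : x ∉ A) (hy : y ∉ A) :
    ∫ r, pushInd A x r * pullInd A y r ∂roundMeasure n = (A.card : ℝ) ^ 2 * edgeProb n 2 := by
  simp only [pushInd, pullInd, Finset.sum_mul_sum]
  rw [integral_finsetSum _ fun _ _ => Integrable.of_finite]
  have h : ∀ w ∈ A, ∫ r, ∑ w' ∈ A, edge x w r * edge w' y r ∂roundMeasure n =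
      A.card * edgeProb n 2 := by
    intro w hw
    rw [integral_finsetSum _ fun _ _ => Integrable.of_finite]
    rw [Finset.sum_congr rfl fun w' hw' => integral_edge_two hn
      (by rintro rfl; exact hx hw') (by rintro rfl; exact hy hw)]
    simp
  rw [Finset.sum_congr rfl h]
  simp
  ring

/-- The k diagonal pairs drop out, since one caller cannot be accepted by both x and y. -/
theorem integral_pushInd_mul_pushInd (hn : 2 ≤ n) (hxy : x ≠ y) :
    ∫ r, pushInd A x r * pushInd A y r ∂roundMeasure n =
      ((A.card : ℝ) ^ 2 - A.card) * edgeProb n 2 := by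
  simp only [pushInd, Finset.sum_mul_sum]
  rw [integral_finsetSum _ fun _ _ => Integrable.of_finite, ← sum_sum_ite_eq]
  refine Finset.sum_congr rfl fun w _ => ?_
  rw [integral_finsetSum _ fun _ _ => Integrable.of_finite]
  refine Finset.sum_congr rfl fun w' _ => ?_
  split_ifs with h
  · subst h
    refine integral_eq_zero_of_ae ?_
    filter_upwards [ae_edge_mul_edge_of_ne n] with r hr
    exact hr _ _ _ hxy
  · exact integral_edge_two hn hxy h

theorem integral_pullInd_mul_pullInd (hn : 2 ≤ n) (hxy : x ≠ y) :
    ∫ r, pullInd A x r * pullInd A y r ∂roundMeasure n =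
      ((A.card : ℝ) ^ 2 - A.card) * edgeProb n 2 := by
  simp only [pullInd, Finset.sum_mul_sum]
  rw [integral_finsetSum _ fun _ _ => Integrable.of_finite, ← sum_sum_ite_eq]
  refine Finset.sum_congr rfl fun w _ => ?_
  rw [integral_finsetSum _ fun _ _ => Integrable.of_finite]
  refine Finset.sum_congr rfl fun w' _ => ?_
  split_ifs with h
  · subst h
    exact integral_eq_zero_of_ae (ae_of_all _ fun r => edge_mul_edge_of_ne _ hxy r)
  · exact integral_edge_two hn h hxy

theorem integral_push_push_pull {z : Fin n} (hn : 3 ≤ n) (hx : x ∉ A) (hy : y ∉ A) (hz : z ∉ A)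
    (hxy : x ≠ y) :
    ∫ r, pushInd A x r * pushInd A y r * pullInd A z r ∂roundMeasure n =
      ((A.card : ℝ) ^ 2 - A.card) * (A.card * edgeProb n 3) := by
  simp only [pushInd, Finset.sum_mul_sum]
  simp only [Finset.sum_mul]
  rw [integral_finsetSum _ fun _ _ => Integrable.of_finite, ← sum_sum_ite_eq]
  refine Finset.sum_congr rfl fun w hw => ?_
  rw [integral_finsetSum _ fun _ _ => Integrable.of_finite]
  refine Finset.sum_congr rfl fun w' hw' => ?_
  split_ifs with h
  · subst h
    refine integral_eq_zero_of_ae ?_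
    filter_upwards [ae_edge_mul_edge_of_ne n] with r hr
    simp [hr _ _ _ hxy]
  · simp only [pullInd, Finset.mul_sum]
    rw [integral_finsetSum _ fun _ _ => Integrable.of_finite]
    rw [Finset.sum_congr rfl fun w'' hw'' => integral_edge_three hn hxy
      (by rintro rfl; exact hx hw'') (by rintro rfl; exact hy hw'') h
      (by rintro rfl; exact hz hw) (by rintro rfl; exact hz hw')]
    simp

theorem integral_pull_pull_push {z : Fin n} (hn : 3 ≤ n) (hx : x ∉ A) (hy : y ∉ A) (hz : z ∉ A)
    (hxy : x ≠ y) :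
    ∫ r, pullInd A x r * pullInd A y r * pushInd A z r ∂roundMeasure n =
      ((A.card : ℝ) ^ 2 - A.card) * (A.card * edgeProb n 3) := by
  simp only [pullInd, Finset.sum_mul_sum]
  simp only [Finset.sum_mul]
  rw [integral_finsetSum _ fun _ _ => Integrable.of_finite, ← sum_sum_ite_eq]
  refine Finset.sum_congr rfl fun w hw => ?_
  rw [integral_finsetSum _ fun _ _ => Integrable.of_finite]
  refine Finset.sum_congr rfl fun w' hw' => ?_
  split_ifs with h
  · subst h
    exact integral_eq_zero_of_ae (ae_of_all _ fun r => by simp [edge_mul_edge_of_ne _ hxy r])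
  · simp only [pushInd, Finset.mul_sum]
    rw [integral_finsetSum _ fun _ _ => Integrable.of_finite]
    rw [Finset.sum_congr rfl fun w'' hw'' => integral_edge_three hn h
      (by rintro rfl; exact hz hw) (by rintro rfl; exact hz hw') hxy
      (by rintro rfl; exact hx hw'') (by rintro rfl; exact hy hw'')]
    simp

theorem edgeProb_nonneg {j : ℕ} (hj : j ≤ n) : 0 ≤ edgeProb n j :=
  div_nonneg (hitProb_nonneg hj) (Nat.cast_nonneg _)

/-- An inequality suffices because this term enters the second moment with a positive sign; the
vanishing diagonal terms are simply overestimated. -/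
theorem integral_push_push_pull_pull_le (hn : 4 ≤ n) (hx : x ∉ A) (hy : y ∉ A) (hxy : x ≠ y) :
    ∫ r, pushInd A x r * pushInd A y r * (pullInd A x r * pullInd A y r) ∂roundMeasure n ≤
      (A.card : ℝ) ^ 4 * edgeProb n 4 := by
  have h4 := edgeProb_nonneg hn
  simp only [pushInd, pullInd, Finset.mul_sum, Finset.sum_mul]
  have h : ∀ w₁ ∈ A, ∀ w₂ ∈ A, ∀ w₃ ∈ A, ∀ w₄ ∈ A,
      ∫ r, edge x w₁ r * edge y w₃ r * (edge w₂ x r * edge w₄ y r) ∂roundMeasure n ≤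
        edgeProb n 4 := by
    intro w₁ h₁ w₂ h₂ w₃ h₃ w₄ h₄
    by_cases h13 : w₁ = w₃
    · subst h13
      refine le_trans (le_of_eq (integral_eq_zero_of_ae ?_)) h4
      filter_upwards [ae_edge_mul_edge_of_ne n] with r hr
      simp [hr _ _ _ hxy]
    by_cases h24 : w₂ = w₄
    · subst h24
      refine le_trans (le_of_eq (integral_eq_zero_of_ae (ae_of_all _ fun r => ?_))) h4
      simp [edge_mul_edge_of_ne _ hxy r]
    have hne : ∀ w ∈ A, w ≠ x ∧ w ≠ y ∧ x ≠ w ∧ y ≠ w := fun w hw =>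
      ⟨by rintro rfl; exact hx hw, by rintro rfl; exact hy hw, by rintro rfl; exact hx hw,
        by rintro rfl; exact hy hw⟩
    simp only [← mul_assoc]
    exact (integral_edge_four hn (by simp [hxy, h24, hne _ h₂, hne _ h₄])
      (by simp [hxy, h13, hne _ h₁, hne _ h₃])).le
  calc _ ≤ ∑ _w₁ ∈ A, ∑ _w₂ ∈ A, ∑ _w₃ ∈ A, ∑ _w₄ ∈ A, edgeProb n 4 := by
        rw [integral_finsetSum _ fun _ _ => Integrable.of_finite]
        refine Finset.sum_le_sum fun w₁ h₁ => ?_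
        rw [integral_finsetSum _ fun _ _ => Integrable.of_finite]
        refine Finset.sum_le_sum fun w₂ h₂ => ?_
        rw [integral_finsetSum _ fun _ _ => Integrable.of_finite]
        refine Finset.sum_le_sum fun w₃ h₃ => ?_
        rw [integral_finsetSum _ fun _ _ => Integrable.of_finite]
        refine Finset.sum_le_sum fun w₄ h₄ => ?_
        exact h _ h₄ _ h₂ _ h₃ _ h₁
    _ = _ := by simp; ring

end Moments

/-! ### Success probabilities and covariances -/

/-- The probability that an uninformed node gets informed when `k` nodes are informed. -/
def informProb (n k : ℕ) : ℝ :=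
  2 * ((k : ℝ) / n) * scaledEdgeProb n 1 - ((k : ℝ) / n) ^ 2 * scaledEdgeProb n 2

/-- The indicator of the event that `x` is informed after a round. -/
def nextInd {n : ℕ} (A : Finset (Fin n)) (x : Fin n) (r : Round n) : ℝ :=
  informedIndicator x (nextInformed r A)

section NextIndicator

variable {n : ℕ} {A : Finset (Fin n)} {x y : Fin n}

theorem pushInd_eq (A : Finset (Fin n)) (x : Fin n) (r : Round n) [Decidable (∃ w ∈ A, r.2 x = some w)] :
    pushInd A x r = if ∃ w ∈ A, r.2 x = some w then 1 else 0 := by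
  split_ifs with h
  · obtain ⟨w, hw, hw'⟩ := h
    rw [pushInd, Finset.sum_eq_single_of_mem w hw]
    · exact if_pos hw'
    · intro b _ hb
      refine if_neg fun h' => hb ?_
      rw [hw'] at h'
      exact (Option.some.inj h').symm
  · refine Finset.sum_eq_zero fun w hw => if_neg fun h' => h ⟨w, hw, h'⟩

theorem pullInd_eq (A : Finset (Fin n)) (x : Fin n) {r : Round n}
    (hr : ∀ v, r.2 v ∈ answers r.1 v) [Decidable (∃ w ∈ A, r.2 w = some x)] :
    pullInd A x r = if ∃ w ∈ A, r.2 w = some x then 1 else 0 := by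
  split_ifs with h
  · obtain ⟨w, hw, hw'⟩ := h
    rw [pullInd, Finset.sum_eq_single_of_mem w hw]
    · exact if_pos hw'
    · intro b _ hb
      refine if_neg fun h' => hb ?_
      have h1 := hr b
      have h2 := hr w
      rw [h', some_mem_answers] at h1
      rw [hw', some_mem_answers] at h2
      exact h1.symm.trans h2
  · refine Finset.sum_eq_zero fun w hw => if_neg fun h' => h ⟨w, hw, h'⟩

theorem ae_nextInd (A : Finset (Fin n)) : ∀ᵐ r ∂roundMeasure n, ∀ x ∉ A,
    nextInd A x r = pushInd A x r + pullInd A x r - pushInd A x r * pullInd A x r := by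
  classical
  filter_upwards [ae_answer_mem n] with r hr x hx
  rw [pushInd_eq, pullInd_eq A x hr]
  have h : x ∈ nextInformed r A ↔ (∃ w ∈ A, r.2 x = some w) ∨ ∃ w ∈ A, r.2 w = some x := by
    simp only [nextInformed, Finset.mem_union, hx, false_or, Finset.mem_filter, Finset.mem_univ,
      true_and, and_or_left, exists_or]
  simp only [nextInd, informedIndicator, h]
  by_cases h1 : ∃ w ∈ A, r.2 x = some w <;> by_cases h2 : ∃ w ∈ A, r.2 w = some x <;>
    simp [h1, h2]

theorem integral_nextInd (hn : 2 ≤ n) (hx : x ∉ A) :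
    ∫ r, nextInd A x r ∂roundMeasure n = informProb n A.card := by
  have h : ∫ r, nextInd A x r ∂roundMeasure n =
      ∫ r, (pushInd A x r + pullInd A x r - pushInd A x r * pullInd A x r) ∂roundMeasure n :=
    integral_congr_ae ((ae_nextInd A).mono fun r hr => hr x hx)
  rw [h, integral_sub Integrable.of_finite Integrable.of_finite,
    integral_add Integrable.of_finite Integrable.of_finite, integral_pushInd (by omega),
    integral_pullInd (by omega), integral_pushInd_mul_pullInd hn hx hx,
    edgeProb_eq (by omega), edgeProb_eq (by omega), informProb]
  ring

/-- Push alone already succeeds with this probability. -/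
theorem half_le_informProb (hn : 2 ≤ n) (hx : x ∉ A) :
    (A.card : ℝ) / n / 2 ≤ informProb n A.card := by
  rw [← integral_nextInd hn hx]
  have h : ∫ r, pushInd A x r ∂roundMeasure n ≤ ∫ r, nextInd A x r ∂roundMeasure n := by
    refine integral_mono_ae Integrable.of_finite Integrable.of_finite ?_
    classical
    filter_upwards [ae_nextInd A, ae_answer_mem n] with r hr hr'
    rw [hr x hx, pushInd_eq, pullInd_eq A x hr']
    split_ifs <;> norm_num
  refine le_trans ?_ h
  rw [integral_pushInd (by omega), edgeProb_eq (by omega), pow_one]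
  have := half_le_scaledEdgeProb_one (n := n) (by omega)
  calc (A.card : ℝ) / n / 2 = A.card / n * (1 / 2) := by ring
    _ ≤ A.card / n * scaledEdgeProb n 1 := by gcongr
    _ = _ := by ring

theorem integral_nextInd_mul_le (hn : 4 ≤ n) (hx : x ∉ A) (hy : y ∉ A) (hxy : x ≠ y) :
    ∫ r, nextInd A x r * nextInd A y r ∂roundMeasure n ≤
      2 * (((A.card : ℝ) ^ 2 - A.card) * edgeProb n 2) + 2 * ((A.card : ℝ) ^ 2 * edgeProb n 2) -
        4 * (((A.card : ℝ) ^ 2 - A.card) * (A.card * edgeProb n 3)) +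
        (A.card : ℝ) ^ 4 * edgeProb n 4 := by
  have h : ∫ r, nextInd A x r * nextInd A y r ∂roundMeasure n =
      ∫ r, (pushInd A x r * pushInd A y r + pullInd A x r * pullInd A y r +
        pushInd A x r * pullInd A y r + pushInd A y r * pullInd A x r -
        pushInd A x r * pushInd A y r * pullInd A x r -
        pushInd A x r * pushInd A y r * pullInd A y r -
        pullInd A x r * pullInd A y r * pushInd A x r -
        pullInd A x r * pullInd A y r * pushInd A y r +
        pushInd A x r * pushInd A y r * (pullInd A x r * pullInd A y r)) ∂roundMeasure n := by
    refine integral_congr_ae ((ae_nextInd A).mono fun r hr => ?_)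
    simp only [hr x hx, hr y hy]
    ring
  rw [h, integral_add Integrable.of_finite Integrable.of_finite,
    integral_sub Integrable.of_finite Integrable.of_finite,
    integral_sub Integrable.of_finite Integrable.of_finite,
    integral_sub Integrable.of_finite Integrable.of_finite,
    integral_sub Integrable.of_finite Integrable.of_finite,
    integral_add Integrable.of_finite Integrable.of_finite,
    integral_add Integrable.of_finite Integrable.of_finite,
    integral_add Integrable.of_finite Integrable.of_finite,
    integral_pushInd_mul_pushInd (by omega) hxy, integral_pullInd_mul_pullInd (by omega) hxy,
    integral_pushInd_mul_pullInd (by omega) hx hy, integral_pushInd_mul_pullInd (by omega) hy hx,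
    integral_push_push_pull (by omega) hx hy hx hxy,
    integral_push_push_pull (by omega) hx hy hy hxy,
    integral_pull_pull_push (by omega) hx hy hx hxy,
    integral_pull_pull_push (by omega) hx hy hy hxy]
  have := integral_push_push_pull_pull_le hn hx hy hxy
  linarith

/-- For aj = q^j and b = 0 the left side vanishes identically, since 4ξ²q² - 4ξ³q³ + ξ⁴q⁴ is the
square of 2ξq - ξ²q². Grouping by powers of ξ leaves three differences of size at most 4δ, with
weights 4, 4, 1, and the term 4b: 16 + 16 + 4 + 4 = 40. -/
theorem covariance_bound_aux {q δ ξ b a1 a2 a3 a4 : ℝ} (hq0 : 0 < q) (hq1 : q < 1) (hδ0 : 0 < δ)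
    (hδ1 : δ ≤ 1) (hξ0 : 0 ≤ ξ) (hξ1 : ξ ≤ 1) (b1 : |a1 - q| ≤ δ) (b2 : |a2 - q ^ 2| ≤ δ)
    (b3 : |a3 - q ^ 3| ≤ δ) (b4 : |a4 - q ^ 4| ≤ δ) (a20 : 0 ≤ a2) (hb : b ≤ δ) :
    4 * ξ ^ 2 * a2 - 4 * ξ ^ 3 * a3 + 4 * ξ ^ 2 * b + ξ ^ 4 * a4 -
      (2 * ξ * a1 - ξ ^ 2 * a2) ^ 2 ≤ 40 * (ξ * δ) := by
  rw [abs_le] at b1 b2 b3 b4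
  have hq2 : q ^ 2 ≤ 1 := pow_le_one₀ hq0.le hq1.le
  have e1 : a2 - a1 ^ 2 ≤ 4 * δ := by nlinarith
  have e2 : a1 * a2 - a3 ≤ 4 * δ := by
    have : a1 * a2 - a3 = (a1 - q) * a2 + q * (a2 - q ^ 2) - (a3 - q ^ 3) := by ring
    have h1 : (a1 - q) * a2 ≤ δ * 2 := mul_le_mul b1.2 (by linarith) a20 hδ0.le
    have h2 : q * (a2 - q ^ 2) ≤ δ :=
      (mul_le_mul_of_nonneg_left b2.2 hq0.le).trans (mul_le_of_le_one_left hδ0.le hq1.le)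
    linarith
  have e3 : a4 - a2 ^ 2 ≤ 4 * δ := by
    have : a4 - a2 ^ 2 = (a4 - q ^ 4) + (q ^ 2 - a2) * (a2 + q ^ 2) := by ring
    have h1 : (q ^ 2 - a2) * (a2 + q ^ 2) ≤ δ * 3 :=
      mul_le_mul (by linarith) (by linarith) (by positivity) hδ0.le
    linarith
  have f1 := mul_le_mul_of_nonneg_left e1 (pow_nonneg hξ0 2)
  have f2 := mul_le_mul_of_nonneg_left e2 (pow_nonneg hξ0 3)
  have f3 := mul_le_mul_of_nonneg_left e3 (pow_nonneg hξ0 4)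
  have f4 := mul_le_mul_of_nonneg_left hb (pow_nonneg hξ0 2)
  have g (j : ℕ) (hj : j ≠ 0) : ξ ^ j * δ ≤ ξ * δ :=
    mul_le_mul_of_nonneg_right (pow_le_of_le_one hξ0 hξ1 hj) hδ0.le
  have g2 := g 2 (by norm_num)
  have g3 := g 3 (by norm_num)
  have g4 := g 4 (by norm_num)
  calc _ = 4 * (ξ ^ 2 * (a2 - a1 ^ 2)) + 4 * (ξ ^ 3 * (a1 * a2 - a3)) + 4 * (ξ ^ 2 * b) +
        ξ ^ 4 * (a4 - a2 ^ 2) := by ring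
    _ ≤ 40 * (ξ * δ) := by linarith

/-- The factor k/n is essential later: it makes the variance of the number of newly informed nodes
O(k), so that relative fluctuations are small when k is large. -/
theorem covariance_nextInd_le (hn : 1000 ≤ n) (hx : x ∉ A) (hy : y ∉ A) (hxy : x ≠ y) :
    covariance (nextInd A x) (nextInd A y) (roundMeasure n) ≤ 40000 * ((A.card : ℝ) / n) / n := by
  have hn' : (1000 : ℝ) ≤ n := by exact_mod_cast hn
  have hn0 : (0 : ℝ) < n := by linarith
  have hk : (A.card : ℝ) ≤ n := by
    have : A.card ≤ n := by simpa using A.card_le_univ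
    exact_mod_cast this
  have hδ1 : 1000 / (n : ℝ) ≤ 1 := by rw [div_le_one hn0]; exact hn'
  have b (j : ℕ) (hj : j ≤ 4) := abs_scaledEdgeProb_sub_le (n := n) (j := j) (by omega) hj
  have a20 : 0 ≤ scaledEdgeProb n 2 := mul_nonneg (by positivity) (edgeProb_nonneg (by omega))
  have b3 := (abs_le.1 (b 3 (by norm_num))).2
  have hq3 : limitHit ^ 3 ≤ 1 :=
    pow_le_one₀ (by have := half_lt_limitHit; linarith) limitHit_lt_one.le
  -- This is the term b of `covariance_bound_aux`; it comes from the missing diagonal in the triple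
  -- moments.
  have hb : scaledEdgeProb n 3 / n ≤ 1000 / n := by
    apply div_le_div_of_nonneg_right _ hn0.le
    linarith
  rw [covariance_eq_sub MemLp.of_discrete MemLp.of_discrete, integral_nextInd (by omega) hx,
    integral_nextInd (by omega) hy]
  have h := integral_nextInd_mul_le (by omega) hx hy hxy
  simp only [Pi.mul_apply]
  generalize hξ : (A.card : ℝ) / n = ξ
  have hξ0 : 0 ≤ ξ := by rw [← hξ]; positivity
  have hξ1 : ξ ≤ 1 := by rw [← hξ, div_le_one hn0]; exact hk
  have hkξ : (A.card : ℝ) = ξ * n := by rw [← hξ]; field_simp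
  have haux := covariance_bound_aux (by have := half_lt_limitHit; linarith) limitHit_lt_one
    (by positivity) hδ1 hξ0 hξ1 (by simpa using b 1 (by norm_num)) (b 2 (by norm_num))
    (b 3 (by norm_num)) (b 4 (by norm_num)) a20 hb
  have hP : 2 * (((A.card : ℝ) ^ 2 - A.card) * edgeProb n 2) +
      2 * ((A.card : ℝ) ^ 2 * edgeProb n 2) -
        4 * (((A.card : ℝ) ^ 2 - A.card) * (A.card * edgeProb n 3)) +
        (A.card : ℝ) ^ 4 * edgeProb n 4 =
      4 * ξ ^ 2 * scaledEdgeProb n 2 - 2 * ξ * scaledEdgeProb n 2 / n -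
        4 * ξ ^ 3 * scaledEdgeProb n 3 + 4 * ξ ^ 2 * (scaledEdgeProb n 3 / n) +
        ξ ^ 4 * scaledEdgeProb n 4 := by
    rw [edgeProb_eq (by omega), edgeProb_eq (by omega), edgeProb_eq (by omega), hkξ]
    field_simp
    ring
  have h5 : 0 ≤ 2 * ξ * scaledEdgeProb n 2 / n := by positivity
  have h6 : informProb n A.card = 2 * ξ * scaledEdgeProb n 1 - ξ ^ 2 * scaledEdgeProb n 2 := by
    rw [informProb, hξ]
  have hfin : 40000 * ξ / n = 40 * (ξ * (1000 / n)) := by ring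
  rw [h6, hfin, ← sq]
  linarith

theorem abs_informProb_sub_le (hn : 1000 ≤ n) {k : ℕ} (hk : k ≤ n) :
    |informProb n k - (2 * limitHit * (k / n) - limitHit ^ 2 * (k / n : ℝ) ^ 2)| ≤
      3000 * (k / n : ℝ) / n := by
  have hn' : (1000 : ℝ) ≤ n := by exact_mod_cast hn
  have hn0 : (0 : ℝ) < n := by linarith
  have b1 := abs_scaledEdgeProb_sub_le (n := n) (j := 1) (by omega) (by norm_num)
  have b2 := abs_scaledEdgeProb_sub_le (n := n) (j := 2) (by omega) (by norm_num)
  rw [pow_one] at b1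
  have hk' : (k : ℝ) ≤ n := by exact_mod_cast hk
  rw [informProb]
  set ξ : ℝ := (k : ℝ) / n with hξ
  have hξ0 : 0 ≤ ξ := by positivity
  have hξ1 : ξ ≤ 1 := by rw [hξ, div_le_one hn0]; exact hk'
  calc _ = |2 * ξ * (scaledEdgeProb n 1 - limitHit) -
        ξ ^ 2 * (scaledEdgeProb n 2 - limitHit ^ 2)| := by congr 1; ring
    _ ≤ |2 * ξ * (scaledEdgeProb n 1 - limitHit)| +
        |ξ ^ 2 * (scaledEdgeProb n 2 - limitHit ^ 2)| := abs_sub _ _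
    _ = 2 * ξ * |scaledEdgeProb n 1 - limitHit| +
        ξ ^ 2 * |scaledEdgeProb n 2 - limitHit ^ 2| := by
        rw [abs_mul (2 * ξ), abs_mul (ξ ^ 2), abs_of_nonneg (by positivity : (0 : ℝ) ≤ 2 * ξ),
          abs_of_nonneg (by positivity : (0 : ℝ) ≤ ξ ^ 2)]
    _ ≤ 2 * ξ * (1000 / n) + ξ * (1000 / n) := by
        have g2 : ξ ^ 2 ≤ ξ := pow_le_of_le_one hξ0 hξ1 (by norm_num)
        gcongr
    _ = _ := by ring

end NextIndicator

/-! ### The shrinking conditions -/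

section Conditions

variable {n : ℕ} {A : Finset (Fin n)} {x y : Fin n}

theorem successProb_eq (hn : 2 ≤ n) (hx : x ∉ A) :
    successProb singleCallPushPull A x = informProb n A.card := by
  rw [← integral_nextInd hn hx, successProb, singleCallPushPull,
    ← PMF.toMeasure_map _ _ Measurable.of_discrete,
    map_measureReal_apply Measurable.of_discrete MeasurableSet.of_discrete,
    ← integral_indicator_one MeasurableSet.of_discrete]
  refine integral_congr_ae (ae_of_all _ fun r => ?_)
  simp only [nextInd, informedIndicator]
  split_ifs with h
  · exact Set.indicator_of_mem (by exact h) _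
  · exact Set.indicator_of_notMem (by exact h) _

theorem roundCov_eq :
    roundCov singleCallPushPull A x y =
      covariance (nextInd A x) (nextInd A y) (roundMeasure n) := by
  rw [roundCov, singleCallPushPull, ← PMF.toMeasure_map _ _ Measurable.of_discrete,
    covariance_map_fun (Measurable.of_discrete.aestronglyMeasurable)
      (Measurable.of_discrete.aestronglyMeasurable) Measurable.of_discrete.aemeasurable]
  rfl

theorem card_compl_cast (A : Finset (Fin n)) : (A.card : ℝ) = n - numUninformed A := by
  have h := Finset.card_add_card_compl A
  rw [Fintype.card_fin] at h
  rw [numUninformed]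
  have h' : (A.card : ℝ) + (Aᶜ.card : ℝ) = n := by exact_mod_cast h
  linarith

theorem one_le_numUninformed (hx : x ∉ A) : 1 ≤ numUninformed A := by
  have : 0 < Aᶜ.card := Finset.card_pos.2 ⟨x, by simpa using hx⟩
  unfold numUninformed
  exact_mod_cast this

theorem one_sub_successProb_bounds (hn : 1000 ≤ n) (hx : x ∉ A) :
    Real.exp (-2) - 3000 * (numUninformed A / n) ≤ 1 - successProb singleCallPushPull A x ∧
      1 - successProb singleCallPushPull A x ≤
        Real.exp (-2) + 3001 * (numUninformed A / n) := by
  have hn' : (1000 : ℝ) ≤ n := by exact_mod_cast hn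
  have hn0 : (0 : ℝ) < n := by linarith
  have hk : A.card ≤ n := by simpa using A.card_le_univ
  have hu := one_le_numUninformed hx
  have h := abs_le.1 (abs_informProb_sub_le hn hk)
  rw [successProb_eq (by omega) hx]
  set η : ℝ := numUninformed A / n with hη
  have hξ : (A.card : ℝ) / n = 1 - η := by
    rw [card_compl_cast, hη]; field_simp
  rw [hξ] at h
  -- As x is itself uninformed, u ≥ 1, so errors of order 1/n are absorbed into multiples of u/n.
  have hη0 : 1 / n ≤ η := by rw [hη]; gcongr
  have hη00 : 0 ≤ η := le_trans (by positivity) hη0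
  have hη1 : η ≤ 1 := by
    have : 0 ≤ (A.card : ℝ) / n := by positivity
    linarith
  have herr : 3000 * (1 - η) / n ≤ 3000 * η := by
    calc 3000 * (1 - η) / n ≤ 3000 * 1 / n := by gcongr; linarith
      _ = 3000 * (1 / n) := by ring
      _ ≤ 3000 * η := by gcongr
  set e := Real.exp (-1) with he
  have he2 : Real.exp (-2) = e ^ 2 := by
    rw [he, ← Real.exp_nat_mul]; norm_num
  have he0 : 0 < e := Real.exp_pos _
  have he1 : e < 1 / 2 := exp_neg_one_lt_half
  have hq : limitHit = 1 - e := rfl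
  rw [hq] at h
  rw [he2]
  -- The left side is (e + (1 - e)η)², where e stands for exp(-1). Its excess over e² is at most (1
  -- - e²)η.
  have key : 1 - (2 * (1 - e) * (1 - η) - (1 - e) ^ 2 * (1 - η) ^ 2) =
      e ^ 2 + 2 * e * (1 - e) * η + (1 - e) ^ 2 * η ^ 2 := by ring
  have k1 : 0 ≤ 2 * e * (1 - e) * η + (1 - e) ^ 2 * η ^ 2 := by
    have : 0 ≤ 1 - e := by linarith
    positivity
  have k2 : 2 * e * (1 - e) * η + (1 - e) ^ 2 * η ^ 2 ≤ η := by
    have : η ^ 2 ≤ η := pow_le_of_le_one hη00 hη1 (by norm_num)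
    have h2 : (1 - e) ^ 2 * η ^ 2 ≤ (1 - e) ^ 2 * η := by gcongr
    nlinarith [mul_nonneg hη00 (sq_nonneg e)]
  constructor <;> linarith [h.1, h.2]

theorem roundCov_le (hn : 1000 ≤ n) (hx : x ∉ A) (hy : y ∉ A) (hxy : x ≠ y) :
    roundCov singleCallPushPull A x y ≤ 40000 / numUninformed A := by
  have hn' : (1000 : ℝ) ≤ n := by exact_mod_cast hn
  have hn0 : (0 : ℝ) < n := by linarith
  have hu := one_le_numUninformed hx
  have hk := card_compl_cast A
  have hk0 : (0 : ℝ) ≤ A.card := Nat.cast_nonneg _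
  rw [roundCov_eq]
  refine (covariance_nextInd_le hn hx hy hxy).trans ?_
  have h1 : (A.card : ℝ) / n ≤ 1 := by rw [div_le_one hn0]; linarith
  calc 40000 * ((A.card : ℝ) / n) / n ≤ 40000 * 1 / n := by gcongr
    _ ≤ 40000 / numUninformed A := by
        rw [mul_one]
        gcongr
        linarith

end Conditions

theorem exp_neg_two_lt : Real.exp (-2) < 1 / 4 := by
  have h := exp_neg_one_lt_half
  have h0 := Real.exp_pos (-1)
  have he2 : Real.exp (-2) = Real.exp (-1) ^ 2 := by
    rw [← Real.exp_nat_mul]; norm_num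
  rw [he2]
  nlinarith

theorem upperExponentialShrinking : UpperExponentialShrinking singleCallPushPull fun _ => 2 := by
  refine ⟨⟨2, 2, by norm_num, fun _ => ⟨le_rfl, le_rfl⟩⟩, 1 / 10000, 3001, 40000, by norm_num,
    by norm_num, by norm_num, by norm_num, fun _ => ?_, 1000, fun n hn A _ _ => ⟨fun x hx => ?_,
    fun x y hx hy hxy => roundCov_le hn hx hy hxy⟩⟩
  · have := exp_neg_two_lt
    linarith
  · exact (one_sub_successProb_bounds hn hx).2

theorem lowerExponentialShrinking : LowerExponentialShrinking singleCallPushPull fun _ => 2 := by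
  refine ⟨⟨2, 2, by norm_num, fun _ => ⟨le_rfl, le_rfl⟩⟩, 1 / 10000, 3000, 40000, by norm_num,
    by norm_num, by norm_num, by norm_num, 1000, fun n hn A _ _ => ⟨fun x hx => ?_,
    fun x y hx hy hxy => roundCov_le hn hx hy hxy⟩⟩
  exact (one_sub_successProb_bounds hn hx).1

-- Sets with ⌈n^(1-α)⌉ uninformed nodes are eventually admissible and have u/n → 0. There the
-- failure probability is at least e⁻² - o(1), whereas the required bound a(u/n)^(ℓ-1) tends to 0.
-- The covariance condition plays no role.
open Filter Topology in
theorem not_upperDoubleExponentialShrinking {α ℓ : ℝ} (hα : 0 < α) (hℓ : 1 < ℓ) :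
    ¬ UpperDoubleExponentialShrinking singleCallPushPull α ℓ := by
  rintro ⟨g, a, c, hg, hg1, ha, hc, hag, N, hN⟩
  set u : ℕ → ℕ := fun n => ⌈(n : ℝ) ^ (1 - α)⌉₊ with hu
  have hlim : Tendsto (fun n : ℕ => (u n : ℝ) / n) atTop (𝓝 0) := by
    have h1 : Tendsto (fun n : ℕ => (n : ℝ) ^ (-α) + 1 / n) atTop (𝓝 (0 + 0)) :=
      ((tendsto_rpow_neg_atTop hα).comp tendsto_natCast_atTop_atTop).add
        tendsto_one_div_atTop_nhds_zero_nat
    rw [add_zero] at h1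
    refine squeeze_zero' (Eventually.of_forall fun n => by positivity) ?_ h1
    filter_upwards [eventually_gt_atTop 0] with n hn
    have hn0 : (0 : ℝ) < n := by exact_mod_cast hn
    have h2 : (u n : ℝ) ≤ (n : ℝ) ^ (1 - α) + 1 := (Nat.ceil_lt_add_one (by positivity)).le
    calc (u n : ℝ) / n ≤ ((n : ℝ) ^ (1 - α) + 1) / n := by gcongr
      _ = (n : ℝ) ^ (-α) + 1 / n := by
        rw [add_div, sub_eq_neg_add, Real.rpow_add hn0, Real.rpow_one]
        field_simp
  have hbound : ∀ᶠ n : ℕ in atTop, Real.exp (-2) - 3000 * ((u n : ℝ) / n) ≤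
      a * ((u n : ℝ) / n) ^ (ℓ - 1) := by
    filter_upwards [eventually_ge_atTop N, eventually_ge_atTop 1000,
      hlim.eventually (eventually_lt_nhds hg), hlim.eventually (eventually_lt_nhds one_pos)]
      with n hnN hn hug hu1
    have hn0 : (0 : ℝ) < n := by
      have : 0 < n := by omega
      exact_mod_cast this
    rw [div_lt_iff₀ hn0] at hug hu1
    rw [one_mul] at hu1
    have hun : u n < n := by exact_mod_cast hu1
    have hupos : 0 < u n := Nat.ceil_pos.2 (by positivity)
    obtain ⟨B, -, hB⟩ := Finset.exists_subset_card_eq (s := (Finset.univ : Finset (Fin n)))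
      (n := u n) (by simpa using hun.le)
    have hnu : numUninformed Bᶜ = u n := by rw [numUninformed, compl_compl, hB]
    have hne : (Bᶜ).Nonempty := by
      rw [← Finset.card_pos, Finset.card_compl, hB, Fintype.card_fin]
      omega
    obtain ⟨x, hx⟩ : B.Nonempty := by rw [← Finset.card_pos, hB]; exact hupos
    have hx' : x ∉ Bᶜ := by simpa using hx
    have h1 := (hN n hnN Bᶜ hne (by rw [hnu]; exact Nat.le_ceil _)
      (by rw [hnu]; exact hug.le)).1 x hx'
    have h2 := (one_sub_successProb_bounds hn hx').1
    rw [hnu] at h1 h2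
    exact h2.trans h1
  have hl1 : Tendsto (fun n : ℕ => Real.exp (-2) - 3000 * ((u n : ℝ) / n)) atTop
      (𝓝 (Real.exp (-2) - 3000 * 0)) := (hlim.const_mul 3000).const_sub _
  have hl2 : Tendsto (fun n : ℕ => a * ((u n : ℝ) / n) ^ (ℓ - 1)) atTop
      (𝓝 (a * (0 : ℝ) ^ (ℓ - 1))) :=
    (hlim.rpow_const (Or.inr (by linarith))).const_mul a
  have h := le_of_tendsto_of_tendsto hl1 hl2 hbound
  rw [Real.zero_rpow (by linarith)] at h
  have := Real.exp_pos (-2)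
  linarith

/-! ### Mean, variance and range of the number of informed nodes -/

section CardMoments

variable {n : ℕ} {A : Finset (Fin n)}

theorem card_nextInformed (A : Finset (Fin n)) (r : Round n) :
    ((nextInformed r A).card : ℝ) = A.card + ∑ x ∈ Aᶜ, nextInd A x r := by
  have h1 : A ⊆ nextInformed r A := Finset.subset_union_left
  have h2 : ∑ x ∈ Aᶜ, nextInd A x r = ((nextInformed r A \ A).card : ℝ) := by
    have : nextInformed r A \ A = Aᶜ.filter fun x => x ∈ nextInformed r A := by
      ext x
      simp only [Finset.mem_sdiff, Finset.mem_filter, Finset.mem_compl]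
      exact and_comm
    simp only [this, nextInd, informedIndicator, Finset.sum_boole]
  rw [h2, ← Finset.card_sdiff_add_card_eq_card h1]
  push_cast
  ring

theorem integral_card_nextInformed (hn : 2 ≤ n) :
    ∫ r, ((nextInformed r A).card : ℝ) ∂roundMeasure n =
      A.card + numUninformed A * informProb n A.card := by
  simp only [card_nextInformed]
  rw [integral_add Integrable.of_finite Integrable.of_finite,
    integral_finsetSum _ fun _ _ => Integrable.of_finite,
    Finset.sum_congr rfl fun x hx => integral_nextInd hn (Finset.mem_compl.1 hx)]
  simp [numUninformed]

theorem informProb_le (hn : 1000 ≤ n) {k : ℕ} (hk : k ≤ n) : informProb n k ≤ 5 * (k / n : ℝ) := by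
  have hn' : (1000 : ℝ) ≤ n := by exact_mod_cast hn
  have hk' : (k : ℝ) ≤ n := by exact_mod_cast hk
  have hn0 : (0 : ℝ) < n := by linarith
  have h := (abs_le.1 (abs_informProb_sub_le hn hk)).2
  have hq := limitHit_lt_one
  generalize hξ : (k : ℝ) / n = ξ at *
  have hξ0 : 0 ≤ ξ := by rw [← hξ]; positivity
  have h1 : 3000 * ξ / n ≤ 3 * ξ := by
    rw [div_le_iff₀ hn0]
    nlinarith
  have h2 : 2 * limitHit * ξ ≤ 2 * ξ := by nlinarith
  have h3 : 0 ≤ limitHit ^ 2 * ξ ^ 2 := by positivity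
  linarith

/-- Each row of the covariance matrix sums to at most 5k/n from the diagonal plus 40000k/n from at
most n off-diagonal entries. -/
theorem integral_sq_card_nextInformed_le (hn : 1000 ≤ n) :
    ∫ r, ((nextInformed r A).card -
        (A.card + numUninformed A * informProb n A.card) : ℝ) ^ 2 ∂roundMeasure n ≤
      40005 * (numUninformed A * ((A.card : ℝ) / n)) := by
  have hn' : (1000 : ℝ) ≤ n := by exact_mod_cast hn
  have hn0 : (0 : ℝ) < n := by linarith
  have hk : A.card ≤ n := by simpa using A.card_le_univ
  have hsum : ∫ r, (∑ x ∈ Aᶜ, nextInd A x) r ∂roundMeasure n =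
      numUninformed A * informProb n A.card := by
    simp only [Finset.sum_apply]
    rw [integral_finsetSum _ fun _ _ => Integrable.of_finite,
      Finset.sum_congr rfl fun x hx => integral_nextInd (by omega) (Finset.mem_compl.1 hx)]
    simp [numUninformed]
  have hvar : ∫ r, ((nextInformed r A).card -
        (A.card + numUninformed A * informProb n A.card) : ℝ) ^ 2 ∂roundMeasure n =
      variance (∑ x ∈ Aᶜ, nextInd A x) (roundMeasure n) := by
    rw [variance_eq_integral Measurable.of_discrete.aemeasurable, hsum]
    refine integral_congr_ae (ae_of_all _ fun r => ?_)
    simp only [card_nextInformed, Finset.sum_apply]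
    ring
  rw [hvar, variance_sum' fun _ _ => MemLp.of_discrete]
  generalize hξ : (A.card : ℝ) / n = ξ
  have hξ0 : 0 ≤ ξ := by rw [← hξ]; positivity
  have hu : numUninformed A ≤ n := by
    have h := card_compl_cast A
    have : (0 : ℝ) ≤ A.card := Nat.cast_nonneg _
    linarith
  have hu0 : 0 ≤ numUninformed A := Nat.cast_nonneg _
  have hdiag : ∀ x ∉ A, covariance (nextInd A x) (nextInd A x) (roundMeasure n) ≤ 5 * ξ := by
    intro x hx
    rw [covariance_eq_sub MemLp.of_discrete MemLp.of_discrete, integral_nextInd (by omega) hx]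
    have h1 : ∫ r, (nextInd A x * nextInd A x) r ∂roundMeasure n = informProb n A.card := by
      rw [← integral_nextInd (by omega) hx]
      refine integral_congr_ae (ae_of_all _ fun r => ?_)
      simp only [Pi.mul_apply, nextInd, informedIndicator]
      split_ifs <;> norm_num
    rw [h1]
    have h2 := informProb_le hn hk
    rw [hξ] at h2
    nlinarith [mul_self_nonneg (informProb n A.card)]
  have hrow : ∀ x ∈ Aᶜ, ∑ y ∈ Aᶜ, covariance (nextInd A x) (nextInd A y) (roundMeasure n) ≤
      40005 * ξ := by
    intro x hx
    rw [← Finset.add_sum_erase _ _ hx]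
    have h1 : ∑ y ∈ Aᶜ.erase x, covariance (nextInd A x) (nextInd A y) (roundMeasure n) ≤
        ∑ _y ∈ Aᶜ.erase x, 40000 * ξ / n := by
      refine Finset.sum_le_sum fun y hy => ?_
      rw [Finset.mem_erase] at hy
      rw [← hξ]
      exact covariance_nextInd_le hn (Finset.mem_compl.1 hx) (Finset.mem_compl.1 hy.2) hy.1.symm
    have h2 : ∑ _y ∈ Aᶜ.erase x, 40000 * ξ / n ≤ 40000 * ξ := by
      rw [Finset.sum_const, nsmul_eq_mul]
      have h3 : ((Aᶜ.erase x).card : ℝ) ≤ n := by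
        refine le_trans ?_ hu
        unfold numUninformed
        exact_mod_cast Finset.card_le_card (Finset.erase_subset _ _)
      calc ((Aᶜ.erase x).card : ℝ) * (40000 * ξ / n) ≤ n * (40000 * ξ / n) := by gcongr
        _ = 40000 * ξ := by field_simp
    have h3 := hdiag x (Finset.mem_compl.1 hx)
    linarith
  calc _ ≤ ∑ _x ∈ Aᶜ, 40005 * ξ := Finset.sum_le_sum hrow
    _ = _ := by
      rw [Finset.sum_const, nsmul_eq_mul, numUninformed]
      ring

theorem card_le_card_nextInformed (A : Finset (Fin n)) (r : Round n) :
    A.card ≤ (nextInformed r A).card := Finset.card_le_card Finset.subset_union_left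

/-- An informed node makes one call and accepts at most one, so it informs at most two others. -/
theorem ae_card_nextInformed_le (A : Finset (Fin n)) :
    ∀ᵐ r ∂roundMeasure n, (nextInformed r A).card ≤ 3 * A.card := by
  filter_upwards [ae_answer_mem n] with r hr
  -- The default value w, used when nobody calls w, lies in A already.
  have h : nextInformed r A ⊆ A ∪ A.image r.1 ∪ A.image fun w => (r.2 w).getD w := by
    intro x hx
    simp only [nextInformed, Finset.mem_union, Finset.mem_filter, Finset.mem_univ, true_and] at hx
    simp only [Finset.mem_union, Finset.mem_image]
    rcases hx with hx | ⟨w, hw, hw' | hw'⟩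
    · exact Or.inl (Or.inl hx)
    · have := hr x
      rw [hw', some_mem_answers] at this
      exact Or.inl (Or.inr ⟨w, hw, this⟩)
    · exact Or.inr ⟨w, hw, by simp [hw']⟩
  calc _ ≤ _ := Finset.card_le_card h
    _ ≤ (A.card + A.card) + A.card := by
      refine (Finset.card_union_le _ _).trans (add_le_add ?_ Finset.card_image_le)
      exact (Finset.card_union_le _ _).trans (add_le_add le_rfl Finset.card_image_le)
    _ = _ := by ring

end CardMoments

/-! ### Expectations of logarithms -/

theorem Real.abs_log_sub_log_le {a b c : ℝ} (hc : 0 < c) (ha : c ≤ a) (hb : c ≤ b) :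
    |Real.log a - Real.log b| ≤ |a - b| / c := by
  have key : ∀ a b : ℝ, c ≤ a → c ≤ b → Real.log a - Real.log b ≤ |a - b| / c := by
    intro a b ha hb
    have ha0 : 0 < a := hc.trans_le ha
    have hb0 : 0 < b := hc.trans_le hb
    rw [← Real.log_div ha0.ne' hb0.ne']
    calc Real.log (a / b) ≤ a / b - 1 := Real.log_le_sub_one_of_pos (by positivity)
      _ = (a - b) / b := by field_simp
      _ ≤ |a - b| / b := by gcongr; exact le_abs_self _
      _ ≤ |a - b| / c := by gcongr
  rw [abs_le]
  have h1 := key a b ha hb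
  have h2 := key b a hb ha
  rw [abs_sub_comm] at h2
  constructor <;> linarith

/-- A global second-order lower bound whose loss grows only like z^(-1/2) near 0. This mild
singularity keeps the end phase under control, where the number of uninformed nodes may fall far
below its mean. The proof sets z = s² and uses log s ≥ 1 - 1/s. -/
theorem Real.sub_one_sub_le_log {z : ℝ} (hz : 0 < z) :
    (z - 1) - 2 * (z - 1) ^ 2 / Real.sqrt z ≤ Real.log z := by
  set s := Real.sqrt z with hs
  have hs0 : 0 < s := Real.sqrt_pos.2 hz
  have hz2 : z = s ^ 2 := (Real.sq_sqrt hz.le).symm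
  have h1 : 2 * (1 - 1 / s) ≤ Real.log z := by
    rw [hz2, Real.log_pow]
    have := Real.one_sub_inv_le_log_of_pos hs0
    rw [one_div]
    push_cast
    linarith
  refine le_trans ?_ h1
  rw [hz2, ← sub_nonneg]
  have : 2 * (1 - 1 / s) - (s ^ 2 - 1 - 2 * (s ^ 2 - 1) ^ 2 / s) =
      (s - 1) ^ 2 * (2 * (s + 1) ^ 2 - (s + 2)) / s := by
    field_simp
    ring
  rw [this]
  have h2 : 0 ≤ 2 * (s + 1) ^ 2 - (s + 2) := by nlinarith
  positivity

/-- The tangent at w = 1 to the convex function w^(-1/2). -/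
theorem Real.three_sub_div_two_le_inv_sqrt {w : ℝ} (hw : 0 < w) :
    (3 - w) / 2 ≤ 1 / Real.sqrt w := by
  set s := Real.sqrt w with hs
  have hs0 : 0 < s := Real.sqrt_pos.2 hw
  have hw2 : w = s ^ 2 := (Real.sq_sqrt hw.le).symm
  rw [hw2, le_div_iff₀ hs0]
  nlinarith [mul_nonneg (sq_nonneg (s - 1)) (by linarith : 0 ≤ s + 2)]

section LogMoments

variable {Ω : Type*} [MeasurableSpace Ω] [DiscreteMeasurableSpace Ω] [Finite Ω]
  {P : Measure Ω} [IsProbabilityMeasure P] {Z : Ω → ℝ} {m c : ℝ}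

theorem integral_log_le_log (hm : 0 < m) (hZ : ∀ᵐ ω ∂P, 0 < Z ω) (hmean : ∫ ω, Z ω ∂P = m) :
    ∫ ω, Real.log (Z ω) ∂P ≤ Real.log m := by
  calc ∫ ω, Real.log (Z ω) ∂P ≤ ∫ ω, (Real.log m + (Z ω / m - 1)) ∂P := by
        refine integral_mono_ae Integrable.of_finite Integrable.of_finite ?_
        filter_upwards [hZ] with ω hω
        have h := Real.log_le_sub_one_of_pos (div_pos hω hm)
        rw [Real.log_div hω.ne' hm.ne'] at h
        linarith
    _ = Real.log m := by
        rw [integral_add Integrable.of_finite Integrable.of_finite,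
          integral_sub Integrable.of_finite Integrable.of_finite, integral_div, hmean]
        simp [hm.ne']

/-- A reverse Jensen inequality: the loss is the relative variance, divided by a lower bound s for
√(Z/m). -/
theorem log_sub_le_integral_log {s v : ℝ} (hm : 0 < m) (hs : 0 < s)
    (hZ : ∀ᵐ ω ∂P, s ^ 2 * m ≤ Z ω) (hmean : ∫ ω, Z ω ∂P = m)
    (hvar : ∫ ω, (Z ω - m) ^ 2 ∂P ≤ v) :
    Real.log m - 2 * v / (s * m ^ 2) ≤ ∫ ω, Real.log (Z ω) ∂P := by
  calc Real.log m - 2 * v / (s * m ^ 2)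
      ≤ Real.log m - 2 * (∫ ω, (Z ω - m) ^ 2 ∂P) / (s * m ^ 2) := by gcongr
    _ = ∫ ω, (Real.log m + (Z ω / m - 1) - 2 / (s * m ^ 2) * (Z ω - m) ^ 2) ∂P := by
        rw [integral_sub Integrable.of_finite Integrable.of_finite,
          integral_add Integrable.of_finite Integrable.of_finite,
          integral_sub Integrable.of_finite Integrable.of_finite, integral_div, hmean,
          integral_const_mul]
        simp [hm.ne']
        ring
    _ ≤ ∫ ω, Real.log (Z ω) ∂P := by
        refine integral_mono_ae Integrable.of_finite Integrable.of_finite ?_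
        filter_upwards [hZ] with ω hω
        have hω0 : 0 < Z ω := lt_of_lt_of_le (by positivity) hω
        have hz : 0 < Z ω / m := div_pos hω0 hm
        have h := Real.sub_one_sub_le_log hz
        rw [Real.log_div hω0.ne' hm.ne'] at h
        have hs2 : s ≤ Real.sqrt (Z ω / m) := by
          apply Real.le_sqrt_of_sq_le
          rw [le_div_iff₀ hm]
          exact hω
        have h2 : 2 * (Z ω / m - 1) ^ 2 / Real.sqrt (Z ω / m) ≤ 2 * (Z ω / m - 1) ^ 2 / s := by
          gcongr
        have h3 : 2 * (Z ω / m - 1) ^ 2 / s = 2 / (s * m ^ 2) * (Z ω - m) ^ 2 := by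
          field_simp
        linarith

end LogMoments

/-! ### The potential, its correction and the deterministic step -/

/-- The logarithm of the growth factor of the early phase. -/
def logGrowth : ℝ := Real.log (1 + 2 * limitHit)

theorem half_le_logGrowth : 1 / 2 ≤ logGrowth := by
  have h1 := half_lt_limitHit
  have h2 : Real.log 2 ≤ logGrowth := Real.log_le_log (by norm_num) (by linarith)
  have h3 := Real.log_two_gt_d9
  linarith

/-- The deterministic part of one round decreases the potential by one, up to an error that
vanishes at both ends. -/
theorem abs_log_step_le {x y : ℝ} (hx : 0 ≤ x) (hy : 0 ≤ y) (hxy : x + y = 1) :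
    |-(1 / logGrowth) * Real.log (1 + y * (2 * limitHit - limitHit ^ 2 * x)) +
      Real.log (1 - limitHit * x) + 1| ≤ 18 * (x * y) := by
  set q := limitHit with hq
  have hq0 : 1 / 2 < q := half_lt_limitHit
  have hq1 : q < 1 := limitHit_lt_one
  have hL := half_le_logGrowth
  have hL0 : 0 < logGrowth := by linarith
  have hLinv : 1 / logGrowth ≤ 2 := by
    rw [div_le_iff₀ hL0]; linarith
  have hx1 : x ≤ 1 := by linarith
  have hy1 : y ≤ 1 := by linarith
  have hqx : q ^ 2 * x ≤ 1 := by
    have : q ^ 2 ≤ 1 := pow_le_one₀ (by linarith) hq1.le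
    nlinarith
  have hqx0 : 0 ≤ q ^ 2 * x := by positivity
  have hM1 : 1 ≤ 1 + y * (2 * q - q ^ 2 * x) := by
    have : 0 ≤ 2 * q - q ^ 2 * x := by linarith
    nlinarith
  have he3 : 1 / 3 ≤ Real.exp (-1) := by
    rw [Real.exp_neg, one_div]
    exact inv_anti₀ (Real.exp_pos _) (by have := Real.exp_one_lt_d9; linarith)
  have hqe : 1 - q = Real.exp (-1) := by rw [hq, limitHit]; ring
  have hB : 1 / 3 ≤ 1 - q * x := by nlinarith
  -- At x = 0 the expression vanishes by the choice of `logGrowth`, and it is Lipschitz in x.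
  have b1 : |-(1 / logGrowth) * Real.log (1 + y * (2 * q - q ^ 2 * x)) +
      Real.log (1 - q * x) + 1| ≤ 9 * x := by
    have e1 : -(1 / logGrowth) * Real.log (1 + y * (2 * q - q ^ 2 * x)) +
        Real.log (1 - q * x) + 1 = (1 / logGrowth) * (Real.log (1 + 2 * q) -
          Real.log (1 + y * (2 * q - q ^ 2 * x))) + (Real.log (1 - q * x) - Real.log 1) := by
      have : Real.log (1 + 2 * q) = logGrowth := rfl
      rw [this, Real.log_one]
      field_simp
      ring
    rw [e1]
    have h1 := Real.abs_log_sub_log_le one_pos (by linarith : 1 ≤ 1 + 2 * q) hM1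
    have h2 := Real.abs_log_sub_log_le (by norm_num : (0 : ℝ) < 1 / 3) hB
      (by norm_num : (1 : ℝ) / 3 ≤ 1)
    have h3 : |1 + 2 * q - (1 + y * (2 * q - q ^ 2 * x))| ≤ 3 * x := by
      have : 1 + 2 * q - (1 + y * (2 * q - q ^ 2 * x)) = x * (2 * q + q ^ 2 * y) := by
        rw [← sub_eq_zero]
        have : y = 1 - x := by linarith
        subst this
        ring
      rw [this, abs_of_nonneg (by positivity)]
      have : q ^ 2 * y ≤ 1 := by nlinarith
      nlinarith
    have h4 : |1 - q * x - 1| ≤ x := by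
      rw [abs_le]; constructor <;> nlinarith
    calc _ ≤ |(1 / logGrowth) * (Real.log (1 + 2 * q) -
          Real.log (1 + y * (2 * q - q ^ 2 * x)))| + |Real.log (1 - q * x) - Real.log 1| :=
          abs_add_le _ _
      _ ≤ 2 * (3 * x) + x / (1 / 3) := by
          rw [abs_mul, abs_of_pos (by positivity : 0 < 1 / logGrowth)]
          gcongr
          · exact (h1.trans_eq (div_one _)).trans h3
          · exact h2.trans (by gcongr)
      _ = 9 * x := by ring
  -- At y = 0 it vanishes because log(1 - q) = -1. This is where the coefficient 1/2 of the second
  -- logarithm is fixed.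
  have b2 : |-(1 / logGrowth) * Real.log (1 + y * (2 * q - q ^ 2 * x)) +
      Real.log (1 - q * x) + 1| ≤ 9 * y := by
    have e1 : -(1 / logGrowth) * Real.log (1 + y * (2 * q - q ^ 2 * x)) +
        Real.log (1 - q * x) + 1 = (1 / logGrowth) * (Real.log 1 -
          Real.log (1 + y * (2 * q - q ^ 2 * x))) +
          (Real.log (1 - q * x) - Real.log (1 - q)) := by
      rw [hqe, Real.log_one, Real.log_exp]
      ring
    rw [e1]
    have h1 := Real.abs_log_sub_log_le one_pos le_rfl hM1
    have h2 := Real.abs_log_sub_log_le (by norm_num : (0 : ℝ) < 1 / 3) hB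
      (by linarith : (1 : ℝ) / 3 ≤ 1 - q)
    have h3 : |1 - (1 + y * (2 * q - q ^ 2 * x))| ≤ 2 * y := by
      have h5 : 0 ≤ 2 * q - q ^ 2 * x := by linarith
      have h6 : 2 * q - q ^ 2 * x ≤ 2 := by linarith
      rw [abs_le]; constructor <;> nlinarith
    have h4 : |1 - q * x - (1 - q)| ≤ y := by
      have : 1 - q * x - (1 - q) = q * y := by
        rw [show y = 1 - x by linarith]
        ring
      rw [this, abs_of_nonneg (by positivity)]
      nlinarith
    calc _ ≤ |(1 / logGrowth) * (Real.log 1 -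
          Real.log (1 + y * (2 * q - q ^ 2 * x)))| + |Real.log (1 - q * x) - Real.log (1 - q)| :=
          abs_add_le _ _
      _ ≤ 2 * (2 * y) + y / (1 / 3) := by
          rw [abs_mul, abs_of_pos (by positivity : 0 < 1 / logGrowth)]
          gcongr
          · exact (h1.trans_eq (div_one _)).trans h3
          · exact h2.trans (by gcongr)
      _ ≤ 9 * y := by linarith
  -- Since x + y = 1, the smaller of x and y is at most 2xy.
  rcases le_total x (1 / 2) with h | h
  · nlinarith
  · nlinarith

/-- The main part of the potential of a state with `κ` informed nodes out of `n`. -/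
def mainPotential (n κ : ℝ) : ℝ :=
  -(1 / logGrowth) * Real.log κ + 1 / 2 * Real.log (n - κ + 1)

/-- The correction term of the potential. -/
def correction (n κ : ℝ) : ℝ := (n - κ) / n + 1 / κ - 1 / Real.sqrt (n - κ + 1)

/-- The order of magnitude of the deviation of the drift of `mainPotential` from `-1`. -/
def driftError (n κ : ℝ) : ℝ :=
  κ / n * ((n - κ) / n) + (n - κ) / n / κ + κ / n / Real.sqrt (n - κ + 1)

/-- Each of the three terms of `correction` decreases in κ, at least linearly on the range that one
round can reach. The bound κ ≤ 3k serves the term 1/κ, the tangent inequality the square root. -/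
theorem correction_sub_le {n k κ : ℝ} (hk : 1 ≤ k) (hkκ : k ≤ κ) (hκ3 : κ ≤ 3 * k)
    (hκn : κ ≤ n) :
    correction n κ - correction n k ≤
      -(κ - k) * (1 / n + 1 / (3 * k ^ 2) + 1 / (2 * (n - k + 1) * Real.sqrt (n - k + 1))) := by
  have hn : 0 < n := by linarith
  have hk0 : 0 < k := by linarith
  have hκ0 : 0 < κ := by linarith
  have hu : 0 < n - k + 1 := by linarith
  have hU : 0 < n - κ + 1 := by linarith
  have h1 : (n - κ) / n - (n - k) / n = -(κ - k) * (1 / n) := by field_simp; ring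
  have h2 : 1 / κ - 1 / k ≤ -(κ - k) * (1 / (3 * k ^ 2)) := by
    have e : 1 / κ - 1 / k = -(κ - k) * (1 / (κ * k)) := by field_simp; ring
    rw [e, neg_mul, neg_mul, neg_le_neg_iff]
    apply mul_le_mul_of_nonneg_left _ (by linarith)
    apply one_div_le_one_div_of_le (by positivity)
    nlinarith
  have h3 : 1 / Real.sqrt (n - k + 1) +
      (κ - k) * (1 / (2 * (n - k + 1) * Real.sqrt (n - k + 1))) ≤ 1 / Real.sqrt (n - κ + 1) := by
    have h := Real.three_sub_div_two_le_inv_sqrt (div_pos hU hu)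
    rw [Real.sqrt_div hU.le] at h
    have hs : 0 < Real.sqrt (n - k + 1) := Real.sqrt_pos.2 hu
    have hS : 0 < Real.sqrt (n - κ + 1) := Real.sqrt_pos.2 hU
    have h4 := mul_le_mul_of_nonneg_left h (one_div_nonneg.2 hs.le)
    have e1 : 1 / Real.sqrt (n - k + 1) *
        (1 / (Real.sqrt (n - κ + 1) / Real.sqrt (n - k + 1))) = 1 / Real.sqrt (n - κ + 1) := by
      field_simp
    rw [e1] at h4
    refine le_trans (le_of_eq ?_) h4
    field_simp
    ring
  unfold correction
  have e : -(κ - k) * (1 / n + 1 / (3 * k ^ 2) + 1 / (2 * (n - k + 1) * Real.sqrt (n - k + 1))) =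
      -(κ - k) * (1 / n) + -(κ - k) * (1 / (3 * k ^ 2)) -
        (κ - k) * (1 / (2 * (n - k + 1) * Real.sqrt (n - k + 1))) := by ring
  rw [e]
  linarith

/-! ### Drift of the potential in one random round -/

section Drift

variable {Ω : Type*} [MeasurableSpace Ω] [DiscreteMeasurableSpace Ω] [Finite Ω]
  {P : Measure Ω} [IsProbabilityMeasure P] {K : Ω → ℝ} {n k p : ℝ}

/-- The expected gain (n - k)p is at least (n - k)k/(2n). Multiplied by the three slopes it
reproduces the three terms of `driftError` with coefficients 1/2, 1/6 and at least 1/8. -/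
theorem integral_correction_le (hk : 1 ≤ k) (hkn : k + 1 ≤ n)
    (hK : ∀ᵐ ω ∂P, k ≤ K ω ∧ K ω ≤ 3 * k ∧ K ω ≤ n)
    (hmean : ∫ ω, K ω ∂P = k + (n - k) * p) (hp : k / n / 2 ≤ p) :
    ∫ ω, correction n (K ω) ∂P ≤ correction n k - driftError n k / 8 := by
  have hk0 : 0 < k := by linarith
  have hn : 0 < n := by linarith
  set u := n - k with hu
  have hu1 : 1 ≤ u := by linarith
  set s := Real.sqrt (u + 1) with hs
  have hs0 : 0 < s := Real.sqrt_pos.2 (by linarith)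
  set c := 1 / n + 1 / (3 * k ^ 2) + 1 / (2 * (u + 1) * s) with hc
  have hc0 : 0 ≤ c := by positivity
  have h1 : ∫ ω, correction n (K ω) ∂P ≤ ∫ ω, (correction n k + -(K ω - k) * c) ∂P := by
    refine integral_mono_ae Integrable.of_finite Integrable.of_finite ?_
    filter_upwards [hK] with ω hω
    have := correction_sub_le hk hω.1 hω.2.1 hω.2.2
    rw [← hu, ← hs, ← hc] at this
    linarith
  have h2 : ∫ ω, (correction n k + -(K ω - k) * c) ∂P = correction n k - u * p * c := by
    rw [integral_add Integrable.of_finite Integrable.of_finite, integral_mul_const,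
      integral_neg, integral_sub Integrable.of_finite Integrable.of_finite, hmean]
    simp
    ring
  have h3 : driftError n k / 8 ≤ u * p * c := by
    have h4 : u * (k / n / 2) * c ≤ u * p * c := by gcongr
    refine le_trans ?_ h4
    have e : u * (k / n / 2) * c = k / n * (u / n) / 2 + u / n / k / 6 +
        u / (u + 1) * (k / n / s) / 4 := by
      rw [hc]
      field_simp
      ring
    rw [e, driftError, ← hu, ← hs]
    have h5 : 1 / 2 ≤ u / (u + 1) := by
      rw [div_le_div_iff₀ (by norm_num) (by linarith)]
      linarith
    have h6 : 1 / 2 * (k / n / s) ≤ u / (u + 1) * (k / n / s) := by gcongr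
    have h7 : 0 ≤ k / n * (u / n) := by positivity
    have h8 : 0 ≤ u / n / k := by positivity
    linarith
  linarith

theorem abs_integral_log_sub_le (hk : 1 ≤ k) (hkn : k + 1 ≤ n)
    (hK : ∀ᵐ ω ∂P, k ≤ K ω ∧ K ω ≤ 3 * k ∧ K ω ≤ n)
    (hmean : ∫ ω, K ω ∂P = k + (n - k) * p)
    (hvar : ∫ ω, (K ω - (k + (n - k) * p)) ^ 2 ∂P ≤ 40005 * ((n - k) * (k / n)))
    (hp : k / n / 2 ≤ p) :
    |∫ ω, Real.log (K ω) ∂P - Real.log (k + (n - k) * p)| ≤ 160020 * ((n - k) / n / k) := by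
  have hk0 : 0 < k := by linarith
  have hn : 0 < n := by linarith
  have hu : 0 < n - k := by linarith
  have hp0 : 0 ≤ p := le_trans (by positivity) hp
  set m := k + (n - k) * p with hm
  have hkm : k ≤ m := by
    have : 0 ≤ (n - k) * p := by positivity
    linarith
  have hm0 : 0 < m := by linarith
  have hm3 : m ≤ 3 * k := by
    rw [← hmean]
    calc ∫ ω, K ω ∂P ≤ ∫ _ω, 3 * k ∂P :=
          integral_mono_ae Integrable.of_finite Integrable.of_finite (hK.mono fun ω h => h.2.1)
      _ = 3 * k := by simp
  have hupper := integral_log_le_log hm0 (hK.mono fun ω h => hk0.trans_le h.1) hmean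
  -- The value s = 1/2 is admissible because K ≥ k ≥ m/3 ≥ m/4.
  have hlower := log_sub_le_integral_log (s := 1 / 2) hm0 (by norm_num)
    (hK.mono fun ω h => by linarith [h.1]) hmean hvar
  have herr : 2 * (40005 * ((n - k) * (k / n))) / (1 / 2 * m ^ 2) ≤
      160020 * ((n - k) / n / k) := by
    calc 2 * (40005 * ((n - k) * (k / n))) / (1 / 2 * m ^ 2)
        ≤ 2 * (40005 * ((n - k) * (k / n))) / (1 / 2 * k ^ 2) := by gcongr
      _ = 160020 * ((n - k) / n / k) := by field_simp; norm_num
  have : 0 ≤ (n - k) / n / k := by positivity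
  rw [abs_le]
  constructor <;> linarith

/-- The variable n - K + 1 is only known to be at least 1, so s = 1/√m is used. The loss
variance·√m/m² is still of order (k/n)/√u for u = n - k, because p ≤ 15/16 keeps m comparable to u +
1. -/
theorem abs_integral_log_uninformed_sub_le (hk : 1 ≤ k) (hkn : k + 1 ≤ n)
    (hK : ∀ᵐ ω ∂P, K ω ≤ n)
    (hmean : ∫ ω, K ω ∂P = k + (n - k) * p)
    (hvar : ∫ ω, (K ω - (k + (n - k) * p)) ^ 2 ∂P ≤ 40005 * ((n - k) * (k / n)))
    (hp1 : p ≤ 15 / 16) :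
    |∫ ω, Real.log (n - K ω + 1) ∂P - Real.log ((n - k) * (1 - p) + 1)| ≤
      10000000 * (k / n / Real.sqrt (n - k + 1)) := by
  have hk0 : 0 < k := by linarith
  have hn : 0 < n := by linarith
  set u := n - k with hu
  have hu0 : 0 < u := by linarith
  set m := u * (1 - p) + 1 with hm
  have hum : (u + 1) / 16 ≤ m := by
    have : u * (1 / 16) ≤ u * (1 - p) := by gcongr; linarith
    linarith
  have hm0 : 0 < m := by linarith
  have hmean' : ∫ ω, (n - K ω + 1) ∂P = m := by
    rw [integral_add Integrable.of_finite Integrable.of_finite,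
      integral_sub Integrable.of_finite Integrable.of_finite, hmean]
    simp
    rw [hm, hu]
    ring
  have hvar' : ∫ ω, (n - K ω + 1 - m) ^ 2 ∂P ≤ 40005 * (u * (k / n)) := by
    refine le_trans (le_of_eq ?_) hvar
    refine integral_congr_ae (ae_of_all _ fun ω => ?_)
    simp only [hm, hu]
    ring
  have hsm : 0 < Real.sqrt m := Real.sqrt_pos.2 hm0
  have hsq : Real.sqrt m ^ 2 = m := Real.sq_sqrt hm0.le
  have hupper := integral_log_le_log (Z := fun ω => n - K ω + 1) hm0
    (hK.mono fun ω h => by linarith) hmean'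
  have hlower := log_sub_le_integral_log (Z := fun ω => n - K ω + 1) (s := 1 / Real.sqrt m) hm0
    (by positivity) (hK.mono fun ω h => by
      rw [div_pow, one_pow, hsq, one_div, inv_mul_cancel₀ hm0.ne']
      linarith) hmean' hvar'
  set s := Real.sqrt (u + 1) with hs
  have hs0 : 0 < s := Real.sqrt_pos.2 (by linarith)
  have hssq : s ^ 2 = u + 1 := Real.sq_sqrt (by linarith)
  have hsms : s / 4 ≤ Real.sqrt m := by
    apply Real.le_sqrt_of_sq_le
    rw [div_pow, hssq]
    linarith
  have herr : 2 * (40005 * (u * (k / n))) / (1 / Real.sqrt m * m ^ 2) ≤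
      10000000 * (k / n / s) := by
    have e1 : 1 / Real.sqrt m * m ^ 2 = Real.sqrt m * m := by
      rw [← hsq]
      field_simp
      rw [Real.sqrt_sq hsm.le]
    rw [e1]
    have h1 : s / 4 * (s ^ 2 / 16) ≤ Real.sqrt m * m := by
      rw [hssq]
      gcongr
    calc 2 * (40005 * (u * (k / n))) / (Real.sqrt m * m)
        ≤ 2 * (40005 * ((u + 1) * (k / n))) / (s / 4 * (s ^ 2 / 16)) := by
          gcongr
          linarith
      _ = 5120640 * (k / n / s) := by
          rw [← hssq]
          field_simp
          norm_num
      _ ≤ 10000000 * (k / n / s) := by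
          have : 0 ≤ k / n / s := by positivity
          linarith
  have : 0 ≤ k / n / s := by positivity
  rw [abs_le]
  constructor <;> linarith

-- The potential at the mean of the next state. Replacing p by its limit 1 - (1 - qx)² costs O(y/k)
-- in the first logarithm and O(x/s) in the second; the rest is `abs_log_step_le`. The bound on p
-- follows from q ≤ 2/3, which gives 1 - (1 - qx)² ≤ 8/9.
set_option maxHeartbeats 800000 in
theorem abs_mainPotential_mean_le (hk : 1 ≤ k) (hkn : k + 1 ≤ n) (hN : 1000000 ≤ n)
    (hp : k / n / 2 ≤ p)
    (happ : |p - (2 * limitHit * (k / n) - limitHit ^ 2 * (k / n) ^ 2)| ≤ 3000 * (k / n) / n) :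
    p ≤ 15 / 16 ∧
    |-(1 / logGrowth) * (Real.log (k + (n - k) * p) - Real.log k) +
      1 / 2 * (Real.log ((n - k) * (1 - p) + 1) - Real.log (n - k + 1)) + 1| ≤
      100000 * driftError n k := by
  have hk0 : 0 < k := by linarith
  have hn : 0 < n := by linarith
  set q := limitHit with hq
  have hq0 : 1 / 2 < q := half_lt_limitHit
  have hq1 : q < 1 := limitHit_lt_one
  have hL := half_le_logGrowth
  have hL0 : 0 < logGrowth := by linarith
  have hLinv : 1 / logGrowth ≤ 2 := by
    rw [div_le_iff₀ hL0]; linarith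
  obtain ⟨u, hu⟩ : ∃ u, u = n - k := ⟨_, rfl⟩
  obtain ⟨x, hx⟩ : ∃ x, x = k / n := ⟨_, rfl⟩
  obtain ⟨y, hy⟩ : ∃ y, y = u / n := ⟨_, rfl⟩
  have hu1 : 1 ≤ u := by linarith
  have hx0 : 0 ≤ x := by rw [hx]; positivity
  have hy0 : 0 ≤ y := by rw [hy]; positivity
  have hxy : x + y = 1 := by rw [hx, hy, hu]; field_simp; ring
  have hx1 : x ≤ 1 := by linarith
  rw [← hx] at hp happ
  rw [driftError, ← hu, ← hx, ← hy]
  obtain ⟨p₀, hp₀⟩ : ∃ p₀, p₀ = 2 * q * x - q ^ 2 * x ^ 2 := ⟨_, rfl⟩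
  rw [← hp₀] at happ
  have hp0 : 0 ≤ p := le_trans (by positivity) hp
  have he3 : 1 / 3 ≤ Real.exp (-1) := by
    rw [Real.exp_neg, one_div]
    exact inv_anti₀ (Real.exp_pos _) (by have := Real.exp_one_lt_d9; linarith)
  have hqe : q ≤ 2 / 3 := by rw [hq, limitHit]; linarith
  have hqxm : q * x ≤ 2 / 3 * 1 := mul_le_mul hqe hx1 hx0 (by norm_num)
  have herr1 : 3000 * x / n ≤ 3 / 1000 := by
    rw [div_le_iff₀ hn]
    linarith
  have hqx : 1 / 3 ≤ 1 - q * x := by linarith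
  have hp₀1 : 1 - p₀ = (1 - q * x) ^ 2 := by rw [hp₀]; ring
  have hp₀2 : 1 / 9 ≤ 1 - p₀ := by
    rw [hp₀1]
    calc (1 : ℝ) / 9 = (1 / 3) ^ 2 := by norm_num
      _ ≤ (1 - q * x) ^ 2 := by gcongr
  have happ' := abs_le.1 happ
  have hp16 : p ≤ 15 / 16 := by linarith [happ'.2]
  refine ⟨hp16, ?_⟩
  have h3x : 3000 * x / n ≤ x := by
    rw [div_le_iff₀ hn, mul_comm]
    exact mul_le_mul_of_nonneg_left (by linarith) hx0
  have hp3 : p ≤ 3 * x := by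
    have : p₀ ≤ 2 * x := by
      rw [hp₀]
      have : 0 ≤ q ^ 2 * x ^ 2 := by positivity
      have : q * x ≤ 1 * x := mul_le_mul_of_nonneg_right hq1.le hx0
      linarith
    linarith [happ'.2]
  obtain ⟨s, hs⟩ : ∃ s, s = Real.sqrt (u + 1) := ⟨_, rfl⟩
  have hs1 : 1 ≤ s := by rw [hs]; exact Real.one_le_sqrt.2 (by linarith)
  have hs0 : 0 < s := by linarith
  have hssq : s ^ 2 = u + 1 := by rw [hs]; exact Real.sq_sqrt (by linarith)
  have hsu : s ≤ u + 1 := by rw [← hssq]; exact le_self_pow₀ hs1 two_ne_zero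
  rw [← hs]
  have hlog1 : Real.log (k + u * p) - Real.log k = Real.log (1 + u / k * p) := by
    rw [← Real.log_div (by positivity) hk0.ne']
    congr 1
    field_simp
  have hlog2 : Real.log (u * (1 - p) + 1) - Real.log (u + 1) =
      Real.log (1 - p + p / (u + 1)) := by
    rw [← Real.log_div _ (by positivity)]
    · congr 1
      field_simp
      ring
    · have : 0 ≤ u * (1 - p) := mul_nonneg (by linarith) (by linarith)
      positivity
  rw [hlog1, hlog2]
  have d1 : |Real.log (1 + u / k * p) - Real.log (1 + y * (2 * q - q ^ 2 * x))| ≤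
      3000 * (y / k) := by
    have hM : y * (2 * q - q ^ 2 * x) = u / k * p₀ := by
      rw [hp₀, hy, hx]
      field_simp
    have hp₀0 : 0 ≤ p₀ := by
      have h : p₀ = x * (2 * q - q ^ 2 * x) := by rw [hp₀]; ring
      rw [h]
      refine mul_nonneg hx0 ?_
      have : 2 * q - q ^ 2 * x = q * (2 - q * x) := by ring
      rw [this]
      exact mul_nonneg (by linarith) (by linarith)
    have h := Real.abs_log_sub_log_le one_pos (by
      have : 0 ≤ u / k * p := by positivity
      linarith : 1 ≤ 1 + u / k * p) (by
      have : 0 ≤ u / k * p₀ := by positivity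
      linarith : 1 ≤ 1 + u / k * p₀)
    rw [hM]
    refine h.trans ?_
    have e : 1 + u / k * p - (1 + u / k * p₀) = u / k * (p - p₀) := by ring
    rw [div_one, e, abs_mul, abs_of_nonneg (by positivity : 0 ≤ u / k)]
    calc u / k * |p - p₀| ≤ u / k * (3000 * x / n) := by gcongr
      _ = 3000 * (y / k) * x := by rw [hy]; ring
      _ ≤ 3000 * (y / k) * 1 := by gcongr
      _ = _ := by ring
  have d2 : |Real.log (1 - p + p / (u + 1)) - 2 * Real.log (1 - q * x)| ≤ 60000 * (x / s) := by
    have e : 2 * Real.log (1 - q * x) = Real.log (1 - p₀) := by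
      rw [hp₀1, Real.log_pow]
      norm_num
    have hpu : 0 ≤ p / (u + 1) := by positivity
    have h := Real.abs_log_sub_log_le (by norm_num : (0 : ℝ) < 1 / 16)
      (by linarith : 1 / 16 ≤ 1 - p + p / (u + 1)) (by linarith : 1 / 16 ≤ 1 - p₀)
    rw [e]
    refine h.trans ?_
    have h1 : |1 - p + p / (u + 1) - (1 - p₀)| ≤ 3003 * (x / s) := by
      calc |1 - p + p / (u + 1) - (1 - p₀)| = |p / (u + 1) - (p - p₀)| := by congr 1; ring
        _ ≤ |p / (u + 1)| + |p - p₀| := abs_sub _ _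
        _ ≤ 3 * x / s + 3000 * x / s := by
            rw [abs_of_nonneg hpu]
            refine add_le_add (by gcongr) (happ.trans ?_)
            gcongr
            linarith
        _ = _ := by ring
    have : 0 ≤ x / s := by positivity
    rw [div_le_iff₀ (by norm_num)]
    linarith
  have d3 := abs_log_step_le hx0 hy0 hxy
  rw [← hq] at d3
  have hxy0 : 0 ≤ x * y := by positivity
  have hyk0 : 0 ≤ y / k := by positivity
  have hxs0 : 0 ≤ x / s := by positivity
  have e : -(1 / logGrowth) * Real.log (1 + u / k * p) +
      1 / 2 * Real.log (1 - p + p / (u + 1)) + 1 =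
      (-(1 / logGrowth) * Real.log (1 + y * (2 * q - q ^ 2 * x)) + Real.log (1 - q * x) + 1) +
      (-(1 / logGrowth) * (Real.log (1 + u / k * p) -
        Real.log (1 + y * (2 * q - q ^ 2 * x))) +
      1 / 2 * (Real.log (1 - p + p / (u + 1)) - 2 * Real.log (1 - q * x))) := by ring
  rw [e]
  refine (abs_add_le _ _).trans ?_
  have h2 := abs_add_le (-(1 / logGrowth) * (Real.log (1 + u / k * p) -
        Real.log (1 + y * (2 * q - q ^ 2 * x))))
      (1 / 2 * (Real.log (1 - p + p / (u + 1)) - 2 * Real.log (1 - q * x)))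
  rw [abs_mul, abs_mul, abs_neg, abs_of_pos (by positivity : 0 < 1 / logGrowth),
    abs_of_pos (by norm_num : (0 : ℝ) < 1 / 2)] at h2
  have h3 : 1 / logGrowth * |Real.log (1 + u / k * p) -
        Real.log (1 + y * (2 * q - q ^ 2 * x))| ≤ 2 * (3000 * (y / k)) := by gcongr
  linarith

theorem abs_integral_mainPotential_le (hk : 1 ≤ k) (hkn : k + 1 ≤ n) (hN : 1000000 ≤ n)
    (hK : ∀ᵐ ω ∂P, k ≤ K ω ∧ K ω ≤ 3 * k ∧ K ω ≤ n)
    (hmean : ∫ ω, K ω ∂P = k + (n - k) * p)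
    (hvar : ∫ ω, (K ω - (k + (n - k) * p)) ^ 2 ∂P ≤ 40005 * ((n - k) * (k / n)))
    (hp : k / n / 2 ≤ p)
    (happ : |p - (2 * limitHit * (k / n) - limitHit ^ 2 * (k / n) ^ 2)| ≤ 3000 * (k / n) / n) :
    |∫ ω, mainPotential n (K ω) ∂P - mainPotential n k + 1| ≤ 10000000 * driftError n k := by
  obtain ⟨hp16, hdet⟩ := abs_mainPotential_mean_le hk hkn hN hp happ
  have h1 := abs_integral_log_sub_le hk hkn hK hmean hvar hp
  have h2 := abs_integral_log_uninformed_sub_le hk hkn (hK.mono fun ω h => h.2.2) hmean hvar hp16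
  have hk0 : 0 < k := by linarith
  have hn : 0 < n := by linarith
  have hu0 : 0 < n - k := by linarith
  have hs0 : 0 < Real.sqrt (n - k + 1) := Real.sqrt_pos.2 (by linarith)
  have hL := half_le_logGrowth
  have hL0 : 0 < logGrowth := by linarith
  have hLinv : 1 / logGrowth ≤ 2 := by
    rw [div_le_iff₀ hL0]; linarith
  have hint : ∫ ω, mainPotential n (K ω) ∂P =
      -(1 / logGrowth) * ∫ ω, Real.log (K ω) ∂P + 1 / 2 * ∫ ω, Real.log (n - K ω + 1) ∂P := by
    simp only [mainPotential]
    rw [integral_add Integrable.of_finite Integrable.of_finite, integral_const_mul,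
      integral_const_mul]
  have e : ∫ ω, mainPotential n (K ω) ∂P - mainPotential n k + 1 =
      (-(1 / logGrowth) * (Real.log (k + (n - k) * p) - Real.log k) +
      1 / 2 * (Real.log ((n - k) * (1 - p) + 1) - Real.log (n - k + 1)) + 1) +
      (-(1 / logGrowth) * (∫ ω, Real.log (K ω) ∂P - Real.log (k + (n - k) * p)) +
      1 / 2 * (∫ ω, Real.log (n - K ω + 1) ∂P - Real.log ((n - k) * (1 - p) + 1))) := by
    rw [hint, mainPotential]
    ring
  rw [e]
  refine (abs_add_le _ _).trans ?_
  have h3 := abs_add_le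
    (-(1 / logGrowth) * (∫ ω, Real.log (K ω) ∂P - Real.log (k + (n - k) * p)))
      (1 / 2 * (∫ ω, Real.log (n - K ω + 1) ∂P - Real.log ((n - k) * (1 - p) + 1)))
  rw [abs_mul, abs_mul, abs_neg, abs_of_pos (by positivity : 0 < 1 / logGrowth),
    abs_of_pos (by norm_num : (0 : ℝ) < 1 / 2)] at h3
  have h4 : 1 / logGrowth * |∫ ω, Real.log (K ω) ∂P - Real.log (k + (n - k) * p)| ≤
      2 * (160020 * ((n - k) / n / k)) := by gcongr
  have a1 : 0 ≤ k / n * ((n - k) / n) := by positivity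
  have a2 : 0 ≤ (n - k) / n / k := by positivity
  have a3 : 0 ≤ k / n / Real.sqrt (n - k + 1) := by positivity
  rw [driftError] at hdet ⊢
  linarith

end Drift

/-! ### The infinite process and additive drift -/

section Rounds

variable {n : ℕ} {s : Fin n}

instance (n : ℕ) : IsProbabilityMeasure (processLaw n) :=
  inferInstanceAs (IsProbabilityMeasure (Measure.infinitePi fun _ : ℕ => roundMeasure n))

theorem informed_nonempty (s : Fin n) (ω : ℕ → Round n) (t : ℕ) : (informed s ω t).Nonempty := by
  induction t with
  | zero => exact Finset.singleton_nonempty s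
  | succ t ih => exact ih.mono Finset.subset_union_left

theorem informed_mono (s : Fin n) (ω : ℕ → Round n) : Monotone (informed s ω) :=
  monotone_nat_of_le_succ fun _ => Finset.subset_union_left

theorem measurable_informed (s : Fin n) (t : ℕ) : Measurable fun ω => informed s ω t := by
  induction t with
  | zero => exact measurable_const
  | succ t ih =>
    have h : Measurable fun q : Round n × Finset (Fin n) => nextInformed q.1 q.2 :=
      Measurable.of_discrete
    exact h.comp ((measurable_pi_apply t).prodMk ih)

theorem informed_congr (s : Fin n) {ω ω' : ℕ → Round n} {t : ℕ} (h : ∀ i < t, ω i = ω' i) :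
    informed s ω t = informed s ω' t := by
  induction t with
  | zero => rfl
  | succ t ih =>
    simp only [informed]
    rw [ih fun i hi => h i (by omega), h t (by omega)]

theorem indepFun_informed (s : Fin n) (t : ℕ) :
    IndepFun (fun ω => informed s ω t) (fun ω => ω t) (processLaw n) := by
  have hind : iIndepFun (fun (i : ℕ) (ω : ℕ → Round n) => ω i) (processLaw n) :=
    iIndepFun_infinitePi (P := fun _ => roundMeasure n) (X := fun _ r => r) fun _ => measurable_id
  have h := hind.indepFun_finset (Finset.range t) {t} (by simp) fun i => measurable_pi_apply i
  -- Some round r₀ is needed to extend a finite history to an infinite sequence; its choice is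
  -- irrelevant, as the state at time t depends only on the rounds before t.
  rcases isEmpty_or_nonempty (Round n) with hE | ⟨⟨r₀⟩⟩
  · have : IsEmpty (ℕ → Round n) := ⟨fun ω => hE.elim (ω 0)⟩
    have h0 : processLaw n = 0 := Measure.eq_zero_of_isEmpty _
    have h1 : (processLaw n) Set.univ = 1 := measure_univ
    rw [h0] at h1
    simp at h1
  · let ext : (Finset.range t → Round n) → ℕ → Round n := fun x i =>
      if hi : i ∈ Finset.range t then x ⟨i, hi⟩ else r₀
    have hext : Measurable ext := by
      refine measurable_pi_lambda _ fun i => ?_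
      by_cases hi : i ∈ Finset.range t
      · simp only [ext, hi, dite_true]
        exact measurable_pi_apply _
      · simp only [ext, hi, dite_false]
        exact measurable_const
    have hcomp := h.comp ((measurable_informed s t).comp hext)
      (measurable_pi_apply (⟨t, Finset.mem_singleton_self t⟩ : ({t} : Finset ℕ)))
    have hfun : (fun ω => informed s ω t) =
        ((fun ω => informed s ω t) ∘ ext) ∘ fun ω (i : Finset.range t) => ω i := by
      funext ω
      refine informed_congr s fun i hi => ?_
      simp [ext, hi]
    rw [hfun]
    exact hcomp

/-- The expected change of `V` in one round started with the informed nodes `A`. -/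
def drift (V : Finset (Fin n) → ℝ) (A : Finset (Fin n)) : ℝ :=
  ∫ r, V (nextInformed r A) ∂roundMeasure n - V A

theorem integrable_comp_informed (s : Fin n) (t : ℕ) (V : Finset (Fin n) → ℝ) :
    Integrable (fun ω => V (informed s ω t)) (processLaw n) := by
  have h : Integrable V ((processLaw n).map fun ω => informed s ω t) := by
    have : IsFiniteMeasure ((processLaw n).map fun ω => informed s ω t) := inferInstance
    exact Integrable.of_finite
  exact h.comp_measurable (measurable_informed s t)

theorem integral_informed_succ (s : Fin n) (t : ℕ) (V : Finset (Fin n) → ℝ) :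
    ∫ ω, V (informed s ω (t + 1)) ∂processLaw n =
      ∫ ω, V (informed s ω t) ∂processLaw n + ∫ ω, drift V (informed s ω t) ∂processLaw n := by
  have hlaw : (processLaw n).map (fun ω => ω t) = roundMeasure n :=
    Measure.infinitePi_map_eval (fun _ : ℕ => roundMeasure n) t
  have hpair := (indepFun_iff_map_prod_eq_prod_map_map
    (measurable_informed s t).aemeasurable (measurable_pi_apply t).aemeasurable).1
    (indepFun_informed s t)
  rw [hlaw] at hpair
  have hprob : IsProbabilityMeasure ((processLaw n).map fun ω => informed s ω t) :=
    Measure.isProbabilityMeasure_map (measurable_informed s t).aemeasurable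
  rw [← integral_add (integrable_comp_informed s t V)
    (integrable_comp_informed s t (drift V))]
  have hR : ∀ ω : ℕ → Round n, V (informed s ω t) + drift V (informed s ω t) =
      (fun A => ∫ r, V (nextInformed r A) ∂roundMeasure n) (informed s ω t) := by
    intro ω
    simp only [drift]
    ring
  have hmeas : Measurable fun ω : ℕ → Round n => (informed s ω t, ω t) :=
    (measurable_informed s t).prodMk (measurable_pi_apply t)
  calc ∫ ω, V (informed s ω (t + 1)) ∂processLaw n
      = ∫ ω, (fun q : Finset (Fin n) × Round n => V (nextInformed q.2 q.1))
          (informed s ω t, ω t) ∂processLaw n := rfl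
    _ = ∫ q, V (nextInformed q.2 q.1)
          ∂((processLaw n).map fun ω => (informed s ω t, ω t)) :=
        (integral_map hmeas.aemeasurable
          (f := fun q : Finset (Fin n) × Round n => V (nextInformed q.2 q.1))
          Measurable.of_discrete.aestronglyMeasurable).symm
    _ = ∫ A, ∫ r, V (nextInformed r A) ∂roundMeasure n
          ∂((processLaw n).map fun ω => informed s ω t) := by
        rw [hpair, integral_prod _ Integrable.of_finite]
    _ = ∫ ω, (fun A => ∫ r, V (nextInformed r A) ∂roundMeasure n) (informed s ω t)
          ∂processLaw n :=
        integral_map (measurable_informed s t).aemeasurable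
          Measurable.of_discrete.aestronglyMeasurable
    _ = _ := by simp only [hR]

/-- The indicator of the event that some node is uninformed. -/
def unfinished (A : Finset (Fin n)) : ℝ := if A = Finset.univ then 0 else 1

/-- The probability that the rumor has not reached all nodes after `t` rounds. -/
def tailProb (s : Fin n) (t : ℕ) : ℝ := ∫ ω, unfinished (informed s ω t) ∂processLaw n

theorem unfinished_nonneg (A : Finset (Fin n)) : 0 ≤ unfinished A := by
  unfold unfinished; split_ifs <;> norm_num

theorem tailProb_nonneg (s : Fin n) (t : ℕ) : 0 ≤ tailProb s t :=
  integral_nonneg fun _ => unfinished_nonneg _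

/-- The informed set is monotone and stays full once full, so the time equals the number of t at
which the process is unfinished. Both sides are infinite if it never finishes. -/
theorem spreadingTime_eq_tsum (s : Fin n) (ω : ℕ → Round n) :
    spreadingTime s ω = ∑' t, ENNReal.ofReal (unfinished (informed s ω t)) := by
  classical
  by_cases h : ∃ t, informed s ω t = Finset.univ
  · have hlt : ∀ t, t < Nat.find h → ENNReal.ofReal (unfinished (informed s ω t)) = 1 := by
      intro t ht
      rw [unfinished, if_neg (Nat.find_min h ht), ENNReal.ofReal_one]
    have hge : ∀ t, t ∉ Finset.range (Nat.find h) →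
        ENNReal.ofReal (unfinished (informed s ω t)) = 0 := by
      intro t ht
      rw [Finset.mem_range, not_lt] at ht
      have h1 := informed_mono s ω ht
      rw [Nat.find_spec h] at h1
      rw [unfinished, if_pos (Finset.eq_univ_iff_forall.2 fun x => h1 (Finset.mem_univ x)),
        ENNReal.ofReal_zero]
    rw [tsum_eq_sum hge, Finset.sum_congr rfl fun t ht => hlt t (Finset.mem_range.1 ht)]
    simp only [Finset.sum_const, Finset.card_range, nsmul_eq_mul, mul_one]
    unfold spreadingTime
    refine le_antisymm (iInf₂_le (Nat.find h) (Nat.find_spec h)) (le_iInf₂ fun t ht => ?_)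
    exact_mod_cast Nat.find_min' h ht
  · push Not at h
    have h1 : ∀ t, ENNReal.ofReal (unfinished (informed s ω t)) = 1 := by
      intro t
      rw [unfinished, if_neg (h t), ENNReal.ofReal_one]
    simp only [h1, ENNReal.tsum_const_eq_top_of_ne_zero one_ne_zero]
    simp [spreadingTime, h]

theorem expectedSpreadingTime_eq_tsum (s : Fin n) :
    expectedSpreadingTime s = ∑' t, ENNReal.ofReal (tailProb s t) := by
  rw [expectedSpreadingTime]
  simp only [spreadingTime_eq_tsum]
  rw [lintegral_tsum (f := fun t ω => ENNReal.ofReal (unfinished (informed s ω t)))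
    fun t => (ENNReal.measurable_ofReal.comp ((Measurable.of_discrete (f := unfinished)).comp (measurable_informed s t))).aemeasurable]
  refine tsum_congr fun t => ?_
  rw [tailProb, ofReal_integral_eq_lintegral_ofReal (integrable_comp_informed s t _)
    (ae_of_all _ fun _ => unfinished_nonneg _)]

theorem sum_tailProb_le {V : Finset (Fin n) → ℝ} {c : ℝ}
    (hV : ∀ A : Finset (Fin n), A.Nonempty → drift V A ≤ c * unfinished A) (N : ℕ) :
    ∫ ω, V (informed s ω N) ∂processLaw n - V {s} ≤ c * ∑ t ∈ Finset.range N, tailProb s t := by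
  induction N with
  | zero => simp [informed]
  | succ N ih =>
    rw [Finset.sum_range_succ, mul_add, integral_informed_succ]
    have h : ∫ ω, drift V (informed s ω N) ∂processLaw n ≤ c * tailProb s N := by
      rw [tailProb, ← integral_const_mul]
      exact integral_mono (integrable_comp_informed s N (drift V))
        ((integrable_comp_informed s N unfinished).const_mul c)
        fun ω => hV _ (informed_nonempty s ω N)
    linarith

/-- A crude potential valid for every n: while some node is uninformed, the expected number of newly
informed nodes is at least 1/(2n). It serves only to make the tail probabilities summable. -/
theorem drift_numUninformed_le (A : Finset (Fin n)) (hA : A.Nonempty) :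
    drift (fun B => 2 * n * numUninformed B) A ≤ (-1) * unfinished A := by
  by_cases hu : A = Finset.univ
  · subst hu
    have : ∀ r : Round n, nextInformed r Finset.univ = Finset.univ := fun r =>
      Finset.eq_univ_iff_forall.2 fun x => Finset.subset_union_left (Finset.mem_univ x)
    simp [drift, unfinished, this]
  · obtain ⟨x, hx⟩ : ∃ x, x ∉ A := by
      by_contra! h
      exact hu (Finset.eq_univ_iff_forall.2 h)
    obtain ⟨y, hy⟩ := hA
    have hn : 2 ≤ n := by
      have h1 : 1 < Fintype.card (Fin n) :=
        Fintype.one_lt_card_iff.2 ⟨x, y, by rintro rfl; exact hx hy⟩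
      rw [Fintype.card_fin] at h1
      omega
    have hn0 : (0 : ℝ) < n := by
      have : 0 < n := by omega
      exact_mod_cast this
    have hp := half_le_informProb hn hx
    have hu1 := one_le_numUninformed hx
    have hk1 : (1 : ℝ) ≤ A.card := by exact_mod_cast Finset.card_pos.2 ⟨y, hy⟩
    have hcard : ∀ B : Finset (Fin n), numUninformed B = n - B.card := fun B => by
      rw [card_compl_cast B]; ring
    have hmean : ∫ r, numUninformed (nextInformed r A) ∂roundMeasure n =
        numUninformed A - numUninformed A * informProb n A.card := by
      simp only [hcard (nextInformed _ A)]
      rw [integral_sub Integrable.of_finite Integrable.of_finite, integral_card_nextInformed hn,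
        hcard A]
      simp
      ring
    rw [drift, integral_const_mul, hmean, unfinished, if_neg hu]
    have h1 : 1 / (n : ℝ) / 2 ≤ informProb n A.card := le_trans (by gcongr) hp
    have h2 : 1 * (1 / (n : ℝ) / 2) ≤ numUninformed A * informProb n A.card := by gcongr
    have h3 : 2 * (n : ℝ) * (1 * (1 / (n : ℝ) / 2)) = 1 := by field_simp
    have h4 := mul_le_mul_of_nonneg_left h2 (by positivity : 0 ≤ 2 * (n : ℝ))
    rw [h3] at h4
    linarith

theorem summable_tailProb (s : Fin n) : Summable (tailProb s) := by
  refine summable_of_sum_range_le (c := 2 * n * numUninformed {s}) (tailProb_nonneg s) fun N => ?_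
  have h := sum_tailProb_le (s := s) (V := fun B => 2 * n * numUninformed B) (c := -1)
    drift_numUninformed_le N
  have h0 : 0 ≤ ∫ ω, 2 * (n : ℝ) * numUninformed (informed s ω N) ∂processLaw n :=
    integral_nonneg fun ω => by
      have : 0 ≤ numUninformed (informed s ω N) := Nat.cast_nonneg _
      simp only [Pi.zero_apply]
      positivity
  linarith

theorem expectedSpreadingTime_eq (s : Fin n) :
    expectedSpreadingTime s = ENNReal.ofReal (∑' t, tailProb s t) := by
  rw [expectedSpreadingTime_eq_tsum,
    ENNReal.ofReal_tsum_of_nonneg (tailProb_nonneg s) (summable_tailProb s)]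

theorem expectedSpreadingTime_ne_top (s : Fin n) : expectedSpreadingTime s ≠ ⊤ := by
  rw [expectedSpreadingTime_eq]
  exact ENNReal.ofReal_ne_top

theorem toReal_expectedSpreadingTime (s : Fin n) :
    (expectedSpreadingTime s).toReal = ∑' t, tailProb s t := by
  rw [expectedSpreadingTime_eq, ENNReal.toReal_ofReal (tsum_nonneg (tailProb_nonneg s))]

-- V is bounded on finitely many states and differs from its final value only while the process is
-- unfinished, so the error is at most M times the tail probability.
open Filter Topology in
theorem tendsto_integral_informed (s : Fin n) (V : Finset (Fin n) → ℝ) :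
    Tendsto (fun N => ∫ ω, V (informed s ω N) ∂processLaw n) atTop (𝓝 (V Finset.univ)) := by
  set M := ∑ A, |V A - V Finset.univ| with hM
  have hb : ∀ A, |V A - V Finset.univ| ≤ M * unfinished A := by
    intro A
    by_cases hA : A = Finset.univ
    · simp [hA, unfinished]
    · rw [unfinished, if_neg hA, mul_one]
      exact Finset.single_le_sum (f := fun A => |V A - V Finset.univ|)
        (fun _ _ => abs_nonneg _) (Finset.mem_univ A)
  have h0 := ((summable_tailProb s).tendsto_atTop_zero).const_mul M
  rw [mul_zero] at h0
  rw [tendsto_iff_norm_sub_tendsto_zero]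
  refine squeeze_zero (fun _ => norm_nonneg _) (fun N => ?_) h0
  have e : ∫ ω, V (informed s ω N) ∂processLaw n - V Finset.univ =
      ∫ ω, (V (informed s ω N) - V Finset.univ) ∂processLaw n := by
    rw [integral_sub (integrable_comp_informed s N V) (integrable_const _)]
    simp
  rw [e, tailProb, ← integral_const_mul]
  refine (norm_integral_le_integral_norm _).trans ?_
  exact integral_mono (integrable_comp_informed s N fun A => ‖V A - V Finset.univ‖)
    ((integrable_comp_informed s N unfinished).const_mul M) fun ω => hb _

open Filter Topology in
/-- Additive drift. -/
theorem sub_le_mul_expectedSpreadingTime {V : Finset (Fin n) → ℝ} {c : ℝ}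
    (hV : ∀ A : Finset (Fin n), A.Nonempty → drift V A ≤ c * unfinished A) :
    V Finset.univ - V {s} ≤ c * (expectedSpreadingTime s).toReal := by
  rw [toReal_expectedSpreadingTime]
  exact le_of_tendsto_of_tendsto' ((tendsto_integral_informed s V).sub_const (V {s}))
    ((summable_tailProb s).hasSum.tendsto_sum_nat.const_mul c) fun N => sum_tailProb_le hV N

end Rounds

/-! ### The expected spreading time -/

section Estimate

variable {n : ℕ}

theorem drift_univ (V : Finset (Fin n) → ℝ) : drift V Finset.univ = 0 := by
  have : ∀ r : Round n, nextInformed r Finset.univ = Finset.univ := fun r =>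
    Finset.eq_univ_iff_forall.2 fun x => Finset.subset_union_left (Finset.mem_univ x)
  simp [drift, this]

theorem card_nextInformed_bounds (A : Finset (Fin n)) :
    ∀ᵐ r ∂roundMeasure n, (A.card : ℝ) ≤ (nextInformed r A).card ∧
      ((nextInformed r A).card : ℝ) ≤ 3 * A.card ∧ ((nextInformed r A).card : ℝ) ≤ n := by
  filter_upwards [ae_card_nextInformed_le A] with r hr
  refine ⟨by exact_mod_cast card_le_card_nextInformed A r, by exact_mod_cast hr, ?_⟩
  have : (nextInformed r A).card ≤ n := by simpa using (nextInformed r A).card_le_univ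
  exact_mod_cast this

theorem drift_mainPotential_correction (hn : 1000000 ≤ n) {A : Finset (Fin n)} (hA : A.Nonempty)
    (hA' : A ≠ Finset.univ) :
    |drift (fun B => mainPotential n B.card) A + 1| ≤ 10000000 * driftError n A.card ∧
      drift (fun B => correction n B.card) A ≤ -(driftError n A.card / 8) := by
  obtain ⟨x, hx⟩ : ∃ x, x ∉ A := by
    by_contra! h
    exact hA' (Finset.eq_univ_iff_forall.2 h)
  have hN : (1000000 : ℝ) ≤ n := by exact_mod_cast hn
  have hk1 : (1 : ℝ) ≤ A.card := by exact_mod_cast hA.card_pos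
  have hu1 := one_le_numUninformed hx
  have hu : numUninformed A = n - A.card := by rw [card_compl_cast A]; ring
  have hkn : (A.card : ℝ) + 1 ≤ n := by linarith
  have hmean := integral_card_nextInformed (A := A) (by omega : 2 ≤ n)
  have hvar := integral_sq_card_nextInformed_le (A := A) (by omega : 1000 ≤ n)
  have hp := half_le_informProb (by omega : 2 ≤ n) hx
  have happ := abs_informProb_sub_le (by omega : 1000 ≤ n)
    (by simpa using A.card_le_univ : A.card ≤ n)
  rw [hu] at hmean hvar
  constructor
  · exact abs_integral_mainPotential_le hk1 hkn hN (card_nextInformed_bounds A) hmean hvar hp happ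
  · have := integral_correction_le hk1 hkn (card_nextInformed_bounds A) hmean hp
    simp only [drift]
    linarith

theorem drift_add_smul (V W : Finset (Fin n) → ℝ) (a b : ℝ) (A : Finset (Fin n)) :
    drift (fun B => a * V B + b * W B) A = a * drift V A + b * drift W A := by
  simp only [drift]
  rw [integral_add Integrable.of_finite Integrable.of_finite, integral_const_mul,
    integral_const_mul]
  ring

theorem abs_expectedSpreadingTime_sub_le (hn : 1000000 ≤ n) (s : Fin n) :
    |(expectedSpreadingTime s).toReal -
      (Real.logb (3 - 2 / Real.exp 1) n + 1 / 2 * Real.log n)| ≤ 240000000 := by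
  have hN : (1000000 : ℝ) ≤ n := by exact_mod_cast hn
  have hn0 : (0 : ℝ) < n := by linarith
  -- The weight 80000000 = 8 · 10000000 makes the drift of `correction` absorb the whole error. As
  -- `correction` varies by at most 3 between the initial and the final state, this costs 240000000.
  have hupper := sub_le_mul_expectedSpreadingTime (s := s) (c := -1)
    (V := fun B => 1 * mainPotential n B.card + 80000000 * correction n B.card) fun A hA => by
      by_cases hA' : A = Finset.univ
      · simp [hA', drift_univ, unfinished]
      · obtain ⟨h1, h2⟩ := drift_mainPotential_correction hn hA hA'
        rw [unfinished, if_neg hA', drift_add_smul]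
        linarith [(abs_le.1 h1).2]
  -- For the lower bound only the sign of the main potential is reversed; the correction keeps its
  -- sign, since its drift must again push downwards.
  have hlower := sub_le_mul_expectedSpreadingTime (s := s) (c := 1)
    (V := fun B => (-1) * mainPotential n B.card + 80000000 * correction n B.card) fun A hA => by
      by_cases hA' : A = Finset.univ
      · simp [hA', drift_univ, unfinished]
      · obtain ⟨h1, h2⟩ := drift_mainPotential_correction hn hA hA'
        rw [unfinished, if_neg hA', drift_add_smul]
        linarith [(abs_le.1 h1).1]
  simp only [Finset.card_univ, Fintype.card_fin, Finset.card_singleton, Nat.cast_one]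
    at hupper hlower
  have hmain : mainPotential n 1 - mainPotential n n =
      Real.logb (3 - 2 / Real.exp 1) n + 1 / 2 * Real.log n := by
    have hb : 1 + 2 * limitHit = 3 - 2 / Real.exp 1 := by
      rw [limitHit, Real.exp_neg]
      ring
    simp only [mainPotential, Real.logb, logGrowth, hb]
    simp
    ring
  have hcorr : |correction n 1 - correction n n| ≤ 3 := by
    have h1 : ((n : ℝ) - 1) / n = 1 - 1 / n := by field_simp
    have h2 : 0 ≤ 1 / (n : ℝ) := by positivity
    have h3 : 1 / (n : ℝ) ≤ 1 / 2 := by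
      apply one_div_le_one_div_of_le <;> linarith
    have h4 : 0 ≤ 1 / Real.sqrt (n : ℝ) := by positivity
    have h5 : 1 / Real.sqrt (n : ℝ) ≤ 1 := by
      rw [div_le_one (Real.sqrt_pos.2 hn0)]
      exact Real.one_le_sqrt.2 (by linarith)
    simp only [correction, h1, sub_self, zero_div, zero_add, Real.sqrt_one, sub_add_cancel]
    rw [abs_le]
    constructor <;> linarith
  have hc := abs_le.1 hcorr
  rw [← hmain, abs_le]
  constructor <;> linarith

theorem exists_abs_expectedSpreadingTime_sub_le : ∃ C : ℝ, ∀ (n : ℕ) (s : Fin n),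
    |(expectedSpreadingTime s).toReal -
      (Real.logb (3 - 2 / Real.exp 1) n + 1 / 2 * Real.log n)| ≤ C := by
  set f : ∀ n : ℕ, Fin n → ℝ := fun n s => |(expectedSpreadingTime s).toReal -
      (Real.logb (3 - 2 / Real.exp 1) n + 1 / 2 * Real.log n)| with hf
  have hf0 : ∀ n s, 0 ≤ f n s := fun _ _ => abs_nonneg _
  have hS0 : 0 ≤ ∑ n ∈ Finset.range 1000000, ∑ s, f n s :=
    Finset.sum_nonneg fun n _ => Finset.sum_nonneg fun s _ => hf0 n s
  -- The finitely many small n are covered by adding all their deviations to the constant.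
  refine ⟨240000000 + ∑ n ∈ Finset.range 1000000, ∑ s, f n s, fun n s => ?_⟩
  rcases le_or_gt 1000000 n with hn | hn
  · linarith [abs_expectedSpreadingTime_sub_le hn s]
  · have h1 : f n s ≤ ∑ s, f n s :=
      Finset.single_le_sum (f := f n) (fun s _ => hf0 n s) (Finset.mem_univ s)
    have h2 : ∑ s, f n s ≤ ∑ n ∈ Finset.range 1000000, ∑ s, f n s :=
      Finset.single_le_sum (f := fun n => ∑ s, f n s)
        (fun n _ => Finset.sum_nonneg fun s _ => hf0 n s) (Finset.mem_range.2 hn)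
    have h3 : f n s ≤ 240000000 + ∑ n ∈ Finset.range 1000000, ∑ s, f n s := by linarith
    exact h3

end Estimate

end

theorem mainTheorem10 :
    (∃ C : ℝ, ∀ (n : ℕ) (s : Fin n),
      expectedSpreadingTime s ≠ ⊤ ∧
      |(expectedSpreadingTime s).toReal -
        (Real.logb (3 - 2 / Real.exp 1) n + 1 / 2 * Real.log n)| ≤ C) ∧
    UpperExponentialShrinking singleCallPushPull (fun _ => 2) ∧
    LowerExponentialShrinking singleCallPushPull (fun _ => 2) ∧
    (∀ α ℓ : ℝ, 0 < α → α ≤ 1 → 1 < ℓ →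
      ¬ UpperDoubleExponentialShrinking singleCallPushPull α ℓ) := by
  obtain ⟨C, hC⟩ := exists_abs_expectedSpreadingTime_sub_le
  exact ⟨⟨C, fun n s => ⟨expectedSpreadingTime_ne_top s, hC n s⟩⟩, upperExponentialShrinking,
    lowerExponentialShrinking, fun _ _ hα _ hℓ => not_upperDoubleExponentialShrinking hα hℓ⟩
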